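/- Let $n\ge 0$, let $T^n=S^1\times\dots\times S^1\subset\mathbb C^n$ carry the flat metric $g$ induced by the real part of the standard hermitian inner product, and let $\Lambda T^n=H^1(\mathbb R/\mathbb Z,T^n)$ be the completion of the smooth loops $\mathbb R/\mathbb Z\to T^n$ with respect to $\|\gamma\|_{1,2}^2=\int_0^1|\gamma|^2\,dt+\int_0^1|\partial_t\gamma|^2\,dt$, with energy functional $\mathcal I(\gamma)=\frac12\int_0^1|\partial_t\gamma(t)|^2\,dt$. For $l\in\mathbb Z^n$ let $$G^l=\{\,t\mapsto(e^{2\pi i(l^1t+q^1)},\dots,e^{2\pi i(l^nt+q^n)})\mid q\in\mathbb R^n/\mathbb Z^n\,\}\subset\Lambda T^n .$$ Fix $k\in\mathbb Z^n$, put $a=2\pi^2|k|^2$ with $|\cdot|$ the euclidean norm, and let $\mathrm{Crit}^a=\{\gamma\in\Lambda T^n\mid d\mathcal I(\gamma)=0,\ \mathcal I(\gamma)\le a\}$, a subspace of $\Lambda T^n$. The Bott-type Morse complex $CM^{a,Bott}_*=CM^{a,Bott}_*(\Lambda T^n,\mathcal I,g;\mathbb Z)$ is the integral singular chain complex of $\mathrm{Crit}^a$,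 graded by $\mathbb Z$ and zero in negative degrees, with the singular boundary operator; $HM^{a,Bott}_i$ denotes its homology, $i\in\mathbb Z$. Then $\mathrm{Crit}^a$ is the union of the pairwise disjoint sets $G^l$ with $l\in\mathbb Z^n$, $|l|\le|k|$, and $CM^{a,Bott}_*$ is isomorphic to the singular chain complex of the topological disjoint union $\bigsqcup_{|l|\le|k|}G^l$. For every $i\in\mathbb Z$, $$HM_i^{a,Bott}\;\cong\;H_i^{sing}\Bigl(\bigsqcup_{l\in\mathbb Z^n,\,|l|\le|k|}T^n;\mathbb Z\Bigr),$$ and $$HM_i^{a,Bott}\;\cong\;\bigoplus_{l\in\mathbb Z^n,\,|l|\le|k|}\mathbb Z^{\binom ni}\quad\text{for } i=0,\dots,n,\qquad HM_i^{a,Bott}=0\ \text{ for all other } i\in\mathbb Z .$$ -/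

import Mathlib

open MeasureTheory CategoryTheory
open scoped ContDiff DirectSum

namespace BottMorse

noncomputable section

/-- The hermitian space `ℂⁿ`; its norm is the one of the hermitian inner product. -/
abbrev Cn (n : ℕ) : Type := EuclideanSpace ℂ (Fin n)

/-- The torus `Tⁿ = S¹ × ⋯ × S¹`, with `S¹` the unit circle of `ℂ`. -/
abbrev Torus (n : ℕ) : Type := Fin n → Circle

/-- Smooth loops `ℝ/ℤ → Tⁿ ⊂ ℂⁿ`, written as 1-periodic smooth maps on `ℝ`. -/
structure SmoothLoop (n : ℕ) where
  toFun : ℝ → Cn n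
  smooth : ContDiff ℝ ∞ toFun
  periodic : Function.Periodic toFun 1
  mem_torus : ∀ t j, ‖toFun t j‖ = 1

/-- A continuous 1-periodic map, as a continuous map on `ℝ/ℤ`. -/
def circleMap {n : ℕ} (f : ℝ → Cn n) (hf : Continuous f) (hp : Function.Periodic f 1) :
    C(UnitAddCircle, Cn n) where
  toFun := hp.lift
  continuous_toFun := continuous_coinduced_dom.mpr hf

theorem periodic_deriv {n : ℕ} {f : ℝ → Cn n} (hp : Function.Periodic f 1) :
    Function.Periodic (deriv f) 1 := by
  intro t
  rw [← deriv_comp_add_const]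
  congr 1
  exact funext hp

/-- `L²(ℝ/ℤ, ℂⁿ)`. -/
abbrev L2 (n : ℕ) : Type := Lp (Cn n) 2 (volume : Measure UnitAddCircle)

/-- The Hilbert space `L²(ℝ/ℤ, ℂⁿ) × L²(ℝ/ℤ, ℂⁿ)`, with `‖(u, v)‖² = ‖u‖² + ‖v‖²`. -/
abbrev Ambient (n : ℕ) : Type := WithLp 2 (L2 n × L2 n)

/-- `γ ↦ (γ, ∂ₜγ)`. The distance of the images of two loops is `‖γ - γ'‖_{1,2}`. -/
def SmoothLoop.jet {n : ℕ} (γ : SmoothLoop n) : Ambient n :=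
  WithLp.toLp 2
    (ContinuousMap.toLp 2 volume ℝ (circleMap γ.toFun γ.smooth.continuous γ.periodic),
     ContinuousMap.toLp 2 volume ℝ
      (circleMap (deriv γ.toFun) (γ.smooth.continuous_deriv (by simp))
        (periodic_deriv γ.periodic)))

/-- The free loop space `ΛTⁿ = H¹(ℝ/ℤ, Tⁿ)`: the completion of the smooth loops in `Tⁿ` for the
norm `‖·‖_{1,2}`, realised as the closure, in a complete space, of their isometric image under
`γ ↦ (γ, ∂ₜγ)`. A point `(γ, v)` is an `H¹` loop `γ` with its weak derivative `v`. -/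
def loopSpace (n : ℕ) : Set (Ambient n) := closure (Set.range SmoothLoop.jet)

/-- The energy `𝓘(γ) = ½ ∫₀¹ |∂ₜγ|² dt`. -/
def energy {n : ℕ} (p : Ambient n) : ℝ :=
  (1 / 2) * ∫ t : UnitAddCircle, ‖p.snd t‖ ^ 2

/-- The critical points of the energy on `ΛTⁿ`: the points of `ΛTⁿ` at which the differential of
the restriction of the energy to the submanifold `ΛTⁿ` vanishes. -/
def crit (n : ℕ) : Set (Ambient n) :=
  {p | p ∈ loopSpace n ∧ HasFDerivWithinAt energy (0 : Ambient n →L[ℝ] ℝ) (loopSpace n) p}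

/-- `Critᵃ = Crit 𝓘 ∩ ΛᵃTⁿ`, the critical points of energy at most `a`. -/
def critBelow (n : ℕ) (a : ℝ) : Set (Ambient n) := {p | p ∈ crit n ∧ energy p ≤ a}

/-- The closed geodesic `t ↦ (exp(2πi(l¹t + q¹)), …, exp(2πi(lⁿt + qⁿ)))`. -/
def geodesic {n : ℕ} (l : Fin n → ℤ) (q : Fin n → ℝ) : SmoothLoop n where
  toFun t := WithLp.toLp 2 fun j ↦
    Complex.exp (2 * Real.pi * Complex.I * ((l j : ℂ) * (t : ℂ) + (q j : ℂ)))
  smooth := by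
    rw [contDiff_piLp]
    intro j
    have h : ContDiff ℝ ∞ (fun t : ℝ ↦ (t : ℂ)) := Complex.ofRealCLM.contDiff
    exact (contDiff_const.mul ((contDiff_const.mul h).add contDiff_const)).cexp
  periodic t := by
    ext j
    show Complex.exp _ = Complex.exp _
    rw [Complex.exp_eq_exp_iff_exists_int]
    exact ⟨l j, by push_cast; ring⟩
  mem_torus t j := by
    show ‖Complex.exp _‖ = 1
    rw [show 2 * (Real.pi : ℂ) * Complex.I * ((l j : ℂ) * (t : ℂ) + (q j : ℂ))
      = ((2 * Real.pi * (l j * t + q j) : ℝ) : ℂ) * Complex.I by push_cast; ring]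
    exact Complex.norm_exp_ofReal_mul_I _

/-- The critical manifold `Gˡ` of all closed geodesics with winding vector `l`. -/
def G {n : ℕ} (l : Fin n → ℤ) : Set (Ambient n) := Set.range fun q ↦ (geodesic l q).jet

/-- The euclidean norm of a lattice vector. -/
def latticeNorm {n : ℕ} (l : Fin n → ℤ) : ℝ := √(∑ j, (l j : ℝ) ^ 2)

/-- The lattice vectors `l` with `|l| ≤ |k|`. -/
abbrev LatticeBall {n : ℕ} (k : Fin n → ℤ) : Type :=
  {l : Fin n → ℤ // latticeNorm l ≤ latticeNorm k}

/-- The inclusion of the degrees `ℕ` into the degrees `ℤ`, for differentials of degree `-1`. -/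
def natToInt : ComplexShape.Embedding (ComplexShape.down ℕ) (ComplexShape.down ℤ) :=
  ComplexShape.Embedding.mk' _ _ (fun i : ℕ ↦ (i : ℤ)) (fun _ _ h ↦ Int.ofNat.inj h)
    (by intro i j; simp only [ComplexShape.down_Rel]; omega)

/-- The complex of integral singular chains of a space, graded by `ℤ` and zero in negative
degrees. -/
def singularChains (X : TopCat.{0}) : ChainComplex (ModuleCat.{0} ℤ) ℤ :=
  (((AlgebraicTopology.singularChainComplexFunctor (ModuleCat.{0} ℤ)).obj
    (ModuleCat.of ℤ ℤ)).obj X).extend natToInt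

/-- Integral singular homology. -/
abbrev singularHomology (X : TopCat.{0}) (i : ℤ) : ModuleCat.{0} ℤ :=
  (singularChains X).homology i

/-- The Bott-type Morse complex of the energy on `ΛTⁿ` below the level `a`: the singular chain
complex of `Critᵃ`, a subspace of `ΛTⁿ`. -/
def CM (n : ℕ) (a : ℝ) : ChainComplex (ModuleCat.{0} ℤ) ℤ :=
  singularChains (TopCat.of (critBelow n a))

/-- The Bott-type Morse homology groups. -/
abbrev HM (n : ℕ) (a : ℝ) (i : ℤ) : ModuleCat.{0} ℤ := (CM n a).homology i

end

end BottMorse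

/-!
The proof has an analytic half, which identifies the critical set, and a topological half, which
computes the singular homology of a finite disjoint union of tori.

**Critical points.** The properties of `H¹` loops that matter are closed conditions on the pair
`(γ, v)` of a loop and its weak derivative, and so pass from smooth loops to their closure: almost
everywhere `γ` lies in the torus and `v` is tangent to it (`ae_tangent_of_mem_loopSpace`), and the
Fourier coefficients of `v` are those of `γ` multiplied by `2πim` (`coef_snd_of_mem_loopSpace`).

* A closed geodesic is critical because the energy of a loop differs from that of the geodesic only
  to second order: in the first-order term `Re ⟨v, v' - v⟩` one integrates by parts to get a
  multiple of `Re ⟨γⱼ, γ'ⱼ - γⱼ⟩` in each coordinate, and this is `-½ ‖γ'ⱼ - γⱼ‖²` for two functions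
  with values in the unit circle (`abs_inner_torusJet_le`).
* Conversely, smooth loops in the group `Tⁿ` act on the loop space by multiplication, so a critical
  point `(γ, v)` may be varied by `ε ↦ e^{iεφ} γ` with `φ` smooth and periodic. The energy along
  this curve is a quadratic polynomial in `ε` (`first_variation`), whence `∫ φ' w = 0` for the
  angular velocity `w` of each coordinate. All Fourier coefficients of `w` of nonzero index vanish,
  so `w` is constant, and then `γ` has a single Fourier mode in each coordinate
  (`exists_eq_fourier`).

The energy of `Gˡ` is `2π²|l|²`, so exactly the `Gˡ` with `|l| ≤ |k|` lie below the level. These are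
finitely many disjoint compact tori, and their union carries the topology of the disjoint union.

**Homology.** The homology of `X × S¹` is found without excision. The projection `X × ℝ → X × S¹` is
a covering with group `ℤ`, and singular simplices lift along it, uniquely up to the deck
transformation `τ`. Therefore `0 → C(X × ℝ) → C(X × ℝ) → C(X × S¹) → 0` is exact, with first map
`1 - τ` (`coverSequence_shortExact`). Since `τ` is homotopic to the identity, `1 - τ` vanishes on
homology, and the long exact sequence falls apart into
`0 → Hᵢ₊₁(X) → Hᵢ₊₁(X × S¹) → Hᵢ(X) → 0`, which splits if `Hᵢ(X)` is free. Starting from a finite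
discrete space `I`, Pascal's rule shows that `Hᵢ(I × Tⁿ)` is free of rank `|I| (n choose i)`
(`isFreeOfRank_homology_prod_torus`).
-/

namespace BottMorse

noncomputable section

/-! ### Free abelian groups on a set with a free action of `ℤ` -/

section Coinvariants

variable {S B : Type*} {τ : S → S} {p : S → B}

/-- A finitely supported function that is constant on infinite orbits vanishes. -/
theorem finsupp_eq_zero_of_mapDomain_eq (hτ : τ.Injective)
    (hfree : ∀ s, Function.Injective fun m : ℕ ↦ τ^[m] s) {f : S →₀ ℤ}
    (hf : f.mapDomain τ = f) : f = 0 := by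
  ext s
  by_contra hs
  have key : ∀ m : ℕ, f (τ^[m] s) = f s := by
    intro m
    induction m with
    | zero => rfl
    | succ m ih =>
      rw [Function.iterate_succ_apply', ← ih]
      conv_lhs => rw [← hf]
      exact Finsupp.mapDomain_apply hτ _ _
  have hmem : ∀ m : ℕ, τ^[m] s ∈ (f.support : Set S) := fun m ↦ by
    simpa [key m] using hs
  exact (Set.infinite_range_of_injective (hfree s)).mono (Set.range_subset_iff.mpr hmem)
    f.support.finite_toSet

/-- The map `1 - τ` on the free abelian group on `S`. -/
def idSubMap (τ : S → S) : (S →₀ ℤ) →ₗ[ℤ] (S →₀ ℤ) :=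
  LinearMap.id - Finsupp.lmapDomain ℤ ℤ τ

theorem idSubMap_injective (hτ : τ.Injective)
    (hfree : ∀ s, Function.Injective fun m : ℕ ↦ τ^[m] s) :
    Function.Injective (idSubMap τ) := by
  rw [injective_iff_map_eq_zero]
  intro f hf
  exact finsupp_eq_zero_of_mapDomain_eq hτ hfree (sub_eq_zero.mp hf).symm

theorem single_sub_single_iterate_mem (s : S) (m : ℕ) (r : ℤ) :
    Finsupp.single s r - Finsupp.single (τ^[m] s) r ∈ LinearMap.range (idSubMap τ) := by
  induction m with
  | zero => simp
  | succ m ih =>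
    have h : Finsupp.single (τ^[m] s) r - Finsupp.single (τ^[m + 1] s) r
        ∈ LinearMap.range (idSubMap τ) :=
      ⟨Finsupp.single (τ^[m] s) r, by
        simp [idSubMap, Finsupp.mapDomain_single, Function.iterate_succ_apply']⟩
    simpa using add_mem ih h

/-- If the fibres of `p : S → B` are the orbits of `τ`, the free abelian group on `B` is the
group of coinvariants of the free abelian group on `S`. -/
theorem exact_idSubMap_lmapDomain (hp : p.Surjective) (hpτ : ∀ s, p (τ s) = p s)
    (hfib : ∀ s s', p s = p s' → ∃ m : ℕ, s' = τ^[m] s ∨ s = τ^[m] s') :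
    Function.Exact (idSubMap τ) (Finsupp.lmapDomain ℤ ℤ p) := by
  intro f
  constructor
  · intro hf
    -- Modulo the image of `1 - τ`, every point may be moved to a chosen point of its fibre.
    let σ := Function.surjInv hp
    have h1 : ∀ g : S →₀ ℤ, g - g.mapDomain (σ ∘ p) ∈ LinearMap.range (idSubMap τ) := by
      intro g
      induction g using Finsupp.induction_linear with
      | zero => simp
      | add f g hf hg =>
        rw [Finsupp.mapDomain_add, add_sub_add_comm]
        exact add_mem hf hg
      | single s r =>
        rw [Finsupp.mapDomain_single]
        obtain ⟨m, h | h⟩ := hfib s (σ (p s)) (Function.surjInv_eq hp (p s)).symm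
        · rw [Function.comp_apply, h]
          exact single_sub_single_iterate_mem s m r
        · have := single_sub_single_iterate_mem (τ := τ) (σ (p s)) m r
          rw [← h] at this
          rw [← neg_sub]
          exact neg_mem this
    have h2 := h1 f
    rw [Finsupp.mapDomain_comp] at h2
    have hf' : f.mapDomain p = 0 := hf
    rw [hf', Finsupp.mapDomain_zero, sub_zero] at h2
    exact h2
  · rintro ⟨g, rfl⟩
    have : p ∘ τ = p := funext hpτ
    change Finsupp.lmapDomain ℤ ℤ p (g - g.mapDomain τ) = 0
    rw [map_sub, Finsupp.lmapDomain_apply, Finsupp.lmapDomain_apply, ← Finsupp.mapDomain_comp,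
      this, sub_self]

end Coinvariants

/-! ### Free abelian groups of finite rank -/

/-- `M` is a free abelian group of finite rank `r`. -/
def IsFreeOfRank (M : Type*) [AddCommGroup M] (r : ℕ) : Prop :=
  Module.Free ℤ M ∧ Module.Finite ℤ M ∧ Module.finrank ℤ M = r

theorem IsFreeOfRank.congr {M N : Type*} [AddCommGroup M] [AddCommGroup N] {r : ℕ}
    (h : IsFreeOfRank M r) (e : M ≃+ N) : IsFreeOfRank N r := by
  obtain ⟨h1, h2, h3⟩ := h
  exact ⟨.of_equiv e.toIntLinearEquiv, .equiv e.toIntLinearEquiv,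
    by rw [← e.toIntLinearEquiv.finrank_eq, h3]⟩

theorem isFreeOfRank_finsupp (I : Type*) [Finite I] : IsFreeOfRank (I →₀ ℤ) (Nat.card I) := by
  have := Fintype.ofFinite I
  exact ⟨inferInstance, inferInstance, by simp⟩

theorem isFreeOfRank_zero (M : Type*) [AddCommGroup M] [Subsingleton M] : IsFreeOfRank M 0 :=
  ⟨inferInstance, inferInstance, Module.finrank_zero_of_subsingleton⟩

theorem IsFreeOfRank.nonempty_equiv {M N : Type*} [AddCommGroup M] [AddCommGroup N] {r : ℕ}
    (h : IsFreeOfRank M r) (h' : IsFreeOfRank N r) : Nonempty (M ≃+ N) := by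
  obtain ⟨h1, h2, h3⟩ := h
  obtain ⟨h1', h2', h3'⟩ := h'
  obtain ⟨e⟩ := FiniteDimensional.nonempty_linearEquiv_of_finrank_eq (h3.trans h3'.symm)
  exact ⟨e.toAddEquiv⟩

/-- An extension of free abelian groups of finite rank splits, so the ranks add up. -/
theorem IsFreeOfRank.of_exact {A M C : Type*} [AddCommGroup A] [AddCommGroup M] [AddCommGroup C]
    {r s : ℕ} (hA : IsFreeOfRank A r) (hC : IsFreeOfRank C s) (f : A →+ M) (g : M →+ C)
    (hf : Function.Injective f) (hg : Function.Surjective g) (hfg : Function.Exact f g) :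
    IsFreeOfRank M (r + s) := by
  obtain ⟨hA1, hA2, hA3⟩ := hA
  obtain ⟨hC1, hC2, hC3⟩ := hC
  obtain ⟨l, hl⟩ := Module.projective_lifting_property g.toIntLinearMap LinearMap.id hg
  have hfg' : Function.Exact f.toIntLinearMap g.toIntLinearMap := hfg
  let e := (hfg'.splitSurjectiveEquiv hf ⟨l, hl⟩).1
  have hprod : IsFreeOfRank (A × C) (r + s) :=
    ⟨inferInstance, inferInstance, by rw [Module.finrank_prod, hA3, hC3]⟩
  exact hprod.congr e.symm.toAddEquiv

/-! ### Simplicial chains as finitely supported functions -/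

/-- The coefficient module `ℤ`. -/
abbrev ZCoeff : ModuleCat.{0} ℤ := ModuleCat.of ℤ ℤ

/-- A coproduct of copies of `ℤ` is a free abelian group. -/
def sigmaZIso (S : Type) : (∐ fun _ : S ↦ ZCoeff : ModuleCat.{0} ℤ) ≅ ModuleCat.of ℤ (S →₀ ℤ) where
  hom := Limits.Sigma.desc fun x ↦ ModuleCat.ofHom (Finsupp.lsingle x)
  inv := ModuleCat.ofHom (Finsupp.linearCombination ℤ fun x ↦
    (Limits.Sigma.ι (fun _ : S ↦ ZCoeff) x).hom (1 : ℤ))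
  hom_inv_id := by
    refine Limits.Sigma.hom_ext _ _ fun x ↦ ?_
    rw [Limits.Sigma.ι_desc_assoc, Category.comp_id]
    ext
    refine (Finsupp.linearCombination_single ..).trans ?_
    exact @one_smul ℤ (∐ fun _ : S ↦ ZCoeff : ModuleCat.{0} ℤ) _
      (ModuleCat.isModule _).toDistribMulAction.toMulAction _
  inv_hom_id := by
    ext x : 2
    ext1
    simp

theorem ι_sigmaZIso_hom {S : Type} (x : S) :
    Limits.Sigma.ι (fun _ : S ↦ ZCoeff) x ≫ (sigmaZIso S).hom =
      ModuleCat.ofHom (Finsupp.lsingle x) :=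
  Limits.Sigma.ι_desc _ _

/-- Integral simplicial `n`-chains as finitely supported functions on the `n`-simplices. -/
def chainIso (X : SSet.{0}) (n : ℕ) :
    (X.chainComplex ZCoeff).X n ≅ ModuleCat.of ℤ (X.obj (.op (.mk n)) →₀ ℤ) :=
  sigmaZIso (X.obj (.op (.mk n)))

theorem ιChainComplex_chainIso_hom {X : SSet.{0}} {n : ℕ} (x : X.obj (.op (.mk n))) :
    X.ιChainComplex x ≫ (chainIso X n).hom = ModuleCat.ofHom (Finsupp.lsingle x) :=
  ι_sigmaZIso_hom x

theorem chainIso_naturality {X Y : SSet.{0}} (f : X ⟶ Y) (n : ℕ) :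
    (SSet.chainComplexMap f ZCoeff).f n ≫ (chainIso Y n).hom =
      (chainIso X n).hom ≫
        ModuleCat.ofHom (Finsupp.lmapDomain ℤ ℤ (f.app (.op (.mk n)))) := by
  refine SSet.chainComplex_hom_ext fun x ↦ ?_
  rw [SSet.ι_chainComplexMap_f_assoc, ιChainComplex_chainIso_hom,
    reassoc_of% ιChainComplex_chainIso_hom]
  ext
  simp [Finsupp.mapDomain_single]

/-! ### The covering `X × ℝ → X × S¹` -/

/-- The covering `X × ℝ → X × S¹`. -/
def coverMap (X : Type) [TopologicalSpace X] : TopCat.of (X × ℝ) ⟶ TopCat.of (X × Circle) :=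
  TopCat.ofHom ((ContinuousMap.id X).prodMap Circle.exp)

/-- The generator `(x, s) ↦ (x, s + 2π)` of the deck transformations of `X × ℝ → X × S¹`. -/
def deck (X : Type) [TopologicalSpace X] : TopCat.of (X × ℝ) ⟶ TopCat.of (X × ℝ) :=
  TopCat.ofHom ((ContinuousMap.id X).prodMap ⟨fun s ↦ s + 2 * Real.pi, by fun_prop⟩)

theorem deck_coverMap (X : Type) [TopologicalSpace X] : deck X ≫ coverMap X = coverMap X := by
  ext ⟨x, s⟩
  · rfl
  · exact congrArg _ (Circle.exp_add_two_pi s)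

/-- Singular simplices of a circle lift to the line: the domain is contractible. -/
theorem exists_lift_exp {m : ℕ} {A : Set (Fin m → ℝ)} (hA : Convex ℝ A) (hne : A.Nonempty)
    (f : C(A, Circle)) : ∃ F : C(A, ℝ), ∀ a, Circle.exp (F a) = f a := by
  obtain ⟨a₀, ha₀⟩ := hne
  -- The contraction of the domain to `a₀` is a homotopy from a constant map to `f`, and it lifts.
  let H : C(unitInterval × A, Circle) := f.comp
    ⟨fun p ↦ ⟨AffineMap.lineMap a₀ (p.2 : Fin m → ℝ) (p.1 : ℝ),
      hA.lineMap_mem ha₀ p.2.2 p.1.2⟩, by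
      refine Continuous.subtype_mk ?_ _
      simp only [AffineMap.lineMap_apply]
      fun_prop⟩
  obtain ⟨s, hs⟩ := Circle.exp_surjective (f ⟨a₀, ha₀⟩)
  have hH0 : ∀ a, H (0, a) = Circle.exp (ContinuousMap.const A s a) := fun a ↦ by
    simp [H, hs]
  let L := Circle.isCoveringMap_exp.liftHomotopy H (.const A s) hH0
  refine ⟨L.comp ⟨fun a ↦ (1, a), by fun_prop⟩, fun a ↦ ?_⟩
  have := congrFun (Circle.isCoveringMap_exp.liftHomotopy_lifts H (.const A s) hH0) (1, a)
  refine this.trans ?_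
  simp [H]

/-- Two maps from a connected space to the line with the same image in the circle differ by a
deck transformation. -/
theorem exists_int_of_exp_eq {A : Type*} [TopologicalSpace A] [ConnectedSpace A] (f g : C(A, ℝ))
    (h : ∀ a, Circle.exp (f a) = Circle.exp (g a)) :
    ∃ m : ℤ, ∀ a, f a = g a + m * (2 * Real.pi) := by
  obtain ⟨a₀⟩ := (inferInstance : Nonempty A)
  obtain ⟨m, hm⟩ := Circle.exp_eq_exp.mp (h a₀)
  refine ⟨m, congrFun (Circle.isCoveringMap_exp.eq_of_comp_eq (g₁ := f)
    (g₂ := fun a ↦ g a + m * (2 * Real.pi)) (by fun_prop) (by fun_prop) ?_ a₀ hm)⟩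
  funext a
  exact (h a).trans (Circle.exp_eq_exp.mpr ⟨-m, by push_cast; ring⟩)

/-- The simplices of the singular simplicial set of `X`. -/
abbrev Sing (X : TopCat.{0}) (n : ℕ) : Type := (TopCat.toSSet.obj X).obj (.op (.mk n))

/-- The continuous map underlying a singular simplex. -/
abbrev simplexMap {X : TopCat.{0}} {n : ℕ} : Sing X n ≃ C(stdSimplex ℝ (Fin (n + 1)), X) :=
  X.toSSetObjEquiv (.op (.mk n))

/-- The action of a continuous map on singular simplices. -/
abbrev singMap {X Y : TopCat.{0}} (f : X ⟶ Y) (n : ℕ) : Sing X n → Sing Y n :=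
  (TopCat.toSSet.map f).app (.op (.mk n))

theorem simplexMap_singMap {X Y : TopCat.{0}} (f : X ⟶ Y) (n : ℕ) (s : Sing X n) :
    simplexMap (singMap f n s) = f.hom.comp (simplexMap s) := rfl

instance (n : ℕ) : ConnectedSpace (stdSimplex ℝ (Fin (n + 1))) :=
  isConnected_iff_connectedSpace.mp
    ((convex_stdSimplex ℝ (Fin (n + 1))).isConnected ⟨_, single_mem_stdSimplex ℝ 0⟩)

section Covering

variable (X : Type) [TopologicalSpace X]

/-- Singular simplices of `X × S¹` lift to `X × ℝ`. -/
theorem singMap_coverMap_surjective (n : ℕ) : (singMap (coverMap X) n).Surjective := by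
  intro b
  let β := simplexMap b
  obtain ⟨F, hF⟩ := exists_lift_exp (convex_stdSimplex ℝ (Fin (n + 1)))
    ⟨_, single_mem_stdSimplex ℝ 0⟩ ((ContinuousMap.snd).comp β)
  refine ⟨simplexMap.symm ((ContinuousMap.fst.comp β).prodMk F), simplexMap.injective ?_⟩
  rw [simplexMap_singMap, Equiv.apply_symm_apply]
  ext1 a
  exact Prod.ext rfl (hF a)

theorem singMap_deck_coverMap (n : ℕ) (s : Sing (.of (X × ℝ)) n) :
    singMap (coverMap X) n (singMap (deck X) n s) = singMap (coverMap X) n s := by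
  apply simplexMap.injective
  rw [simplexMap_singMap, simplexMap_singMap, simplexMap_singMap]
  exact congrArg (fun f : TopCat.of (X × ℝ) ⟶ TopCat.of (X × Circle) ↦
    f.hom.comp (simplexMap s)) (deck_coverMap X)

theorem simplexMap_iterate_deck (n m : ℕ) (s : Sing (.of (X × ℝ)) n)
    (a : stdSimplex ℝ (Fin (n + 1))) :
    simplexMap ((singMap (deck X) n)^[m] s) a =
      ((simplexMap s a).1, (simplexMap s a).2 + m * (2 * Real.pi)) := by
  induction m with
  | zero => simp
  | succ m ih =>
    rw [Function.iterate_succ_apply', simplexMap_singMap, ContinuousMap.comp_apply, ih]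
    refine Prod.ext rfl ?_
    change (simplexMap s a).2 + m * (2 * Real.pi) + 2 * Real.pi = _
    push_cast
    ring

theorem iterate_singMap_deck_injective (n : ℕ) (s : Sing (.of (X × ℝ)) n) :
    Function.Injective fun m : ℕ ↦ (singMap (deck X) n)^[m] s := by
  intro m m' h
  have h1 := congrArg (fun s ↦ simplexMap s ⟨_, single_mem_stdSimplex ℝ 0⟩) h
  have h2 := (Prod.ext_iff.mp (((simplexMap_iterate_deck ..).symm.trans h1).trans
    (simplexMap_iterate_deck ..))).2
  simpa [Real.pi_ne_zero] using h2

theorem singMap_deck_injective (n : ℕ) : (singMap (deck X) n).Injective := by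
  intro s s' h
  apply simplexMap.injective
  ext1 a
  have h1 : ((simplexMap s a).1, (simplexMap s a).2 + 2 * Real.pi) =
      ((simplexMap s' a).1, (simplexMap s' a).2 + 2 * Real.pi) :=
    congrArg (fun s ↦ simplexMap s a) h
  exact Prod.ext (Prod.ext_iff.mp h1).1 (add_right_cancel (Prod.ext_iff.mp h1).2)

/-- Two lifts of the same singular simplex differ by a deck transformation. -/
theorem exists_iterate_deck_of_coverMap_eq (n : ℕ) (s s' : Sing (.of (X × ℝ)) n)
    (h : singMap (coverMap X) n s = singMap (coverMap X) n s') :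
    ∃ m : ℕ, s' = (singMap (deck X) n)^[m] s ∨ s = (singMap (deck X) n)^[m] s' := by
  have h1 : ∀ a, (simplexMap s a).1 = (simplexMap s' a).1 ∧
      Circle.exp (simplexMap s a).2 = Circle.exp (simplexMap s' a).2 := fun a ↦
    Prod.ext_iff.mp (congrArg (fun s ↦ simplexMap s a) h)
  obtain ⟨m, hm⟩ := exists_int_of_exp_eq (ContinuousMap.snd.comp (simplexMap s))
    (ContinuousMap.snd.comp (simplexMap s')) fun a ↦ (h1 a).2
  obtain ⟨k, rfl | rfl⟩ := m.eq_nat_or_neg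
  · refine ⟨k, .inr (simplexMap.injective ?_)⟩
    ext1 a
    rw [simplexMap_iterate_deck]
    exact Prod.ext (h1 a).1 (hm a)
  · refine ⟨k, .inl (simplexMap.injective ?_)⟩
    ext1 a
    rw [simplexMap_iterate_deck]
    refine Prod.ext (h1 a).1.symm ?_
    have := hm a
    simp only [ContinuousMap.comp_apply, ContinuousMap.snd_apply] at this
    simp [this]

/-! ### The homology of `X × S¹` -/

/-- Integral singular chains, graded by `ℕ`. -/
abbrev chains (X : TopCat.{0}) : ChainComplex (ModuleCat.{0} ℤ) ℕ :=
  ((AlgebraicTopology.singularChainComplexFunctor (ModuleCat.{0} ℤ)).obj ZCoeff).obj X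

/-- The chain map of a continuous map. -/
abbrev chainsMap {X Y : TopCat.{0}} (f : X ⟶ Y) : chains X ⟶ chains Y :=
  ((AlgebraicTopology.singularChainComplexFunctor (ModuleCat.{0} ℤ)).obj ZCoeff).map f

theorem chainsMap_comp {X Y Z : TopCat.{0}} (f : X ⟶ Y) (g : Y ⟶ Z) :
    chainsMap (f ≫ g) = chainsMap f ≫ chainsMap g := Functor.map_comp ..

/-- The sequence `0 → C(X × ℝ) → C(X × ℝ) → C(X × S¹) → 0` of singular chain complexes whose first
map is `1 - τ`, for the generating deck transformation `τ`. -/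
def coverSequence : ShortComplex (ChainComplex (ModuleCat.{0} ℤ) ℕ) :=
  .mk (𝟙 (chains (.of (X × ℝ))) - chainsMap (deck X)) (chainsMap (coverMap X)) (by
    rw [Preadditive.sub_comp, Category.id_comp, ← chainsMap_comp, deck_coverMap, sub_self])

/-- In each degree the singular chains of `X × S¹` are the coinvariants of the free action of the
deck transformations on the singular chains of `X × ℝ`. -/
theorem coverSequence_shortExact : (coverSequence X).ShortExact := by
  refine HomologicalComplex.shortExact_of_degreewise_shortExact _ fun n ↦ ?_
  let T : ShortComplex (ModuleCat.{0} ℤ) :=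
    .mk (ModuleCat.ofHom (idSubMap (singMap (deck X) n)))
      (ModuleCat.ofHom (Finsupp.lmapDomain ℤ ℤ (singMap (coverMap X) n))) (by
        ext1
        exact (exact_idSubMap_lmapDomain (singMap_coverMap_surjective X n)
          (singMap_deck_coverMap X n)
          (exists_iterate_deck_of_coverMap_eq X n)).linearMap_comp_eq_zero)
  have hT : T.ShortExact := ModuleCat.shortComplex_shortExact _
    (exact_idSubMap_lmapDomain (singMap_coverMap_surjective X n)
          (singMap_deck_coverMap X n) (exists_iterate_deck_of_coverMap_eq X n))
    (idSubMap_injective (singMap_deck_injective X n) (iterate_singMap_deck_injective X n))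
    (Finsupp.mapDomain_surjective (singMap_coverMap_surjective X n))
  have hf : (chainsMap (deck X)).f n ≫ (chainIso _ n).hom = _ :=
    chainIso_naturality (TopCat.toSSet.map (deck X)) n
  have hg : (chainsMap (coverMap X)).f n ≫ (chainIso _ n).hom = _ :=
    chainIso_naturality (TopCat.toSSet.map (coverMap X)) n
  refine ShortComplex.shortExact_of_iso (ShortComplex.isoMk (S₁ := T.map (𝟭 _))
    (S₂ := (coverSequence X).map (HomologicalComplex.eval _ _ n))
    (chainIso (TopCat.toSSet.obj (.of (X × ℝ))) n).symm
    (chainIso (TopCat.toSSet.obj (.of (X × ℝ))) n).symm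
    (chainIso (TopCat.toSSet.obj (.of (X × Circle))) n).symm ?_ ?_) hT
  · refine (Iso.inv_comp_eq (chainIso (TopCat.toSSet.obj (.of (X × ℝ))) n)).mpr ?_
    refine Eq.trans ?_ (Category.assoc _ _ _)
    refine (Iso.eq_comp_inv (chainIso (TopCat.toSSet.obj (.of (X × ℝ))) n)).mpr ?_
    refine (Preadditive.sub_comp (𝟙 ((chains (.of (X × ℝ))).X n)) ((chainsMap (deck X)).f n)
      (chainIso _ n).hom).trans (Eq.trans ?_ (Preadditive.comp_sub (chainIso _ n).hom (𝟙 _)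
        (ModuleCat.ofHom (Finsupp.lmapDomain ℤ ℤ (singMap (deck X) n)))).symm)
    exact congrArg₂ (· - ·) ((Category.id_comp _).trans (Category.comp_id _).symm) hf
  · refine (Iso.inv_comp_eq (chainIso (TopCat.toSSet.obj (.of (X × ℝ))) n)).mpr ?_
    refine Eq.trans ?_ (Category.assoc _ _ _)
    exact (Iso.eq_comp_inv (chainIso (TopCat.toSSet.obj (.of (X × Circle))) n)).mpr hg

/-- Integral singular homology, graded by `ℕ`. -/
abbrev natHomology (X : TopCat.{0}) (i : ℕ) : ModuleCat.{0} ℤ := (chains X).homology i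

/-- The deck transformation is homotopic to the identity, through translations of `ℝ`. -/
theorem homologyMap_deck (i : ℕ) :
    HomologicalComplex.homologyMap (chainsMap (deck X)) i = 𝟙 _ := by
  let H : TopCat.Homotopy (deck X) (𝟙 _) :=
    (ContinuousMap.Homotopy.refl (ContinuousMap.id X)).prodMap
      (ContinuousMap.Homotopy.affine ⟨fun s ↦ s + 2 * Real.pi, by fun_prop⟩ (.id ℝ))
  rw [H.congr_homologyMap_singularChainComplexFunctor, CategoryTheory.Functor.map_id,
    HomologicalComplex.homologyMap_id]

/-- The projection `X × ℝ → X` is a homotopy equivalence and so induces isomorphisms on homology. -/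
def homologyProdRealIso (i : ℕ) : natHomology (.of (X × ℝ)) i ≅ natHomology (.of X) i where
  hom := HomologicalComplex.homologyMap (chainsMap (TopCat.ofHom ContinuousMap.fst)) i
  inv := HomologicalComplex.homologyMap (chainsMap (TopCat.ofHom
    ((ContinuousMap.id X).prodMk (.const X 0)))) i
  hom_inv_id := by
    rw [← HomologicalComplex.homologyMap_comp, ← chainsMap_comp]
    let H : TopCat.Homotopy (TopCat.ofHom (ContinuousMap.fst (α := X) (β := ℝ)) ≫
        TopCat.ofHom ((ContinuousMap.id X).prodMk (.const X 0))) (𝟙 (TopCat.of (X × ℝ))) :=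
      (ContinuousMap.Homotopy.refl (ContinuousMap.id X)).prodMap
        (ContinuousMap.Homotopy.affine (.const ℝ 0) (.id ℝ))
    rw [H.congr_homologyMap_singularChainComplexFunctor, CategoryTheory.Functor.map_id,
      HomologicalComplex.homologyMap_id]
  inv_hom_id := by
    rw [← HomologicalComplex.homologyMap_comp, ← chainsMap_comp]
    exact (congrArg (HomologicalComplex.homologyMap · i) (CategoryTheory.Functor.map_id _ _)).trans
      (HomologicalComplex.homologyMap_id _ _)

theorem homologyMap_coverSequence_f (i : ℕ) :
    HomologicalComplex.homologyMap (coverSequence X).f i = 0 := by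
  change HomologicalComplex.homologyMap (𝟙 (chains (.of (X × ℝ))) - chainsMap (deck X)) i = 0
  rw [HomologicalComplex.homologyMap_sub, homologyMap_deck, HomologicalComplex.homologyMap_id,
    sub_self]

theorem homologyMap_coverSequence_g_injective (i : ℕ) :
    Function.Injective (HomologicalComplex.homologyMap (coverSequence X).g i).hom := by
  have h := (ShortComplex.ShortExact.moduleCat_exact_iff_function_exact _).mp
    ((coverSequence_shortExact X).homology_exact₂ i)
  rw [injective_iff_map_eq_zero]
  intro x hx
  obtain ⟨y, rfl⟩ := (h x).mp hx
  exact congr($(homologyMap_coverSequence_f X i) y)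

theorem isFreeOfRank_homology_prod_circle_zero {r : ℕ}
    (h : IsFreeOfRank (natHomology (.of X) 0) r) :
    IsFreeOfRank (natHomology (.of (X × Circle)) 0) r := by
  have hS := coverSequence_shortExact X
  have := hS.epi_g
  have : Epi ((coverSequence X).g.f 0) := inferInstance
  have hepi : Epi (HomologicalComplex.homologyMap (coverSequence X).g 0) :=
    HomologicalComplex.epi_homologyMap_of_epi_of_not_rel _ _ (by simp)
  exact h.congr ((homologyProdRealIso X 0).toLinearEquiv.symm.trans
    (.ofBijective _ ⟨homologyMap_coverSequence_g_injective X 0,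
      (ModuleCat.epi_iff_surjective _).mp hepi⟩)).toAddEquiv

/-- The short exact sequence `0 → Hᵢ₊₁(X) → Hᵢ₊₁(X × S¹) → Hᵢ(X) → 0`. -/
theorem isFreeOfRank_homology_prod_circle_succ {i r s : ℕ}
    (h : IsFreeOfRank (natHomology (.of X) (i + 1)) r)
    (h' : IsFreeOfRank (natHomology (.of X) i) s) :
    IsFreeOfRank (natHomology (.of (X × Circle)) (i + 1)) (r + s) := by
  have hS := coverSequence_shortExact X
  have hrel : (ComplexShape.down ℕ).Rel (i + 1) i := rfl
  have h3 := (ShortComplex.ShortExact.moduleCat_exact_iff_function_exact _).mp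
    (hS.homology_exact₃ (i + 1) i hrel)
  have h1 := (ShortComplex.ShortExact.moduleCat_exact_iff_function_exact _).mp
    (hS.homology_exact₁ (i + 1) i hrel)
  refine IsFreeOfRank.of_exact
    (h.congr (homologyProdRealIso X (i + 1)).toLinearEquiv.symm.toAddEquiv)
    (h'.congr (homologyProdRealIso X i).toLinearEquiv.symm.toAddEquiv)
    (HomologicalComplex.homologyMap (coverSequence X).g (i + 1)).hom.toAddMonoidHom
    (hS.δ (i + 1) i hrel).hom.toAddMonoidHom
    (homologyMap_coverSequence_g_injective X (i + 1)) (fun x ↦ ?_) h3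
  exact (h1 x).mp congr($(homologyMap_coverSequence_f X i) x)

end Covering

/-! ### Disjoint unions of tori -/

/-- A homeomorphism induces an isomorphism on homology. -/
theorem IsFreeOfRank.homology_congr {X Y : Type} [TopologicalSpace X] [TopologicalSpace Y]
    (e : X ≃ₜ Y) {i r : ℕ} (h : IsFreeOfRank (natHomology (.of X) i) r) :
    IsFreeOfRank (natHomology (.of Y) i) r :=
  h.congr ((HomologicalComplex.homologyFunctor _ _ i).mapIso
    (((AlgebraicTopology.singularChainComplexFunctor _).obj ZCoeff).mapIso
      (TopCat.isoOfHomeo (X := .of X) (Y := .of Y) e))).toLinearEquiv.toAddEquiv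

theorem isFreeOfRank_homology_discrete (I : Type) [TopologicalSpace I] [TotallyDisconnectedSpace I]
    [Finite I] (i : ℕ) : IsFreeOfRank (natHomology (.of I) i) (Nat.card I * Nat.choose 0 i) := by
  have : TotallyDisconnectedSpace (TopCat.of I) := ‹_›
  cases i with
  | zero =>
    rw [Nat.choose_self, mul_one]
    exact (isFreeOfRank_finsupp I).congr ((sigmaZIso I).toLinearEquiv.symm.toAddEquiv.trans
      (AlgebraicTopology.singularHomologyFunctorZeroOfTotallyDisconnectedSpace
        (ModuleCat.{0} ℤ) ZCoeff (.of I)).toLinearEquiv.symm.toAddEquiv)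
  | succ i =>
    have h := AlgebraicTopology.isZero_singularHomologyFunctor_of_totallyDisconnectedSpace
      (ModuleCat.{0} ℤ) (i + 1) ZCoeff (.of I) (by simp)
    have : Subsingleton (natHomology (.of I) (i + 1)) := ModuleCat.subsingleton_of_isZero h
    exact isFreeOfRank_zero _

/-- The torus `Tⁿ⁺¹` is the product of `Tⁿ` and a circle. -/
def torusSuccHomeomorph (n : ℕ) : Torus n × Circle ≃ₜ Torus (n + 1) where
  toFun p := Fin.cons p.2 p.1
  invFun z := (Fin.tail z, z 0)
  left_inv p := by simp
  right_inv z := by simp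
  continuous_toFun := by
    refine continuous_pi fun j ↦ ?_
    refine Fin.cases ?_ (fun j ↦ ?_) j
    · exact continuous_snd
    · exact (continuous_apply j).comp continuous_fst
  continuous_invFun := by
    refine Continuous.prodMk (continuous_pi fun j ↦ ?_) (continuous_apply 0)
    exact continuous_apply j.succ

/-- The index set is carried along as a discrete factor, so that the disjoint union of tori is
reached by taking products with a circle only. -/
theorem isFreeOfRank_homology_prod_torus (I : Type) [TopologicalSpace I]
    [TotallyDisconnectedSpace I] [Finite I] (n i : ℕ) :
    IsFreeOfRank (natHomology (.of (I × Torus n)) i) (Nat.card I * n.choose i) := by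
  induction n generalizing i with
  | zero =>
    exact (isFreeOfRank_homology_discrete I i).homology_congr (Homeomorph.prodUnique I _).symm
  | succ n ih =>
    let e : (I × Torus n) × Circle ≃ₜ I × Torus (n + 1) :=
      (Homeomorph.prodAssoc ..).trans ((Homeomorph.refl I).prodCongr (torusSuccHomeomorph n))
    refine IsFreeOfRank.homology_congr e ?_
    cases i with
    | zero =>
      simpa using isFreeOfRank_homology_prod_circle_zero _ (ih 0)
    | succ i =>
      rw [Nat.choose_succ_succ', mul_add, add_comm (Nat.card I * _)]
      exact isFreeOfRank_homology_prod_circle_succ _ (ih (i + 1)) (ih i)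

/-- Homology in a degree `i ≥ 0` does not change when the chain complex is extended by zero. -/
def singularHomologyNatEquiv (X : TopCat.{0}) (i : ℕ) :
    singularHomology X i ≃ₗ[ℤ] natHomology X i :=
  (HomologicalComplex.extendHomologyIso (chains X) natToInt (j := i) (j' := (i : ℤ))
    rfl).toLinearEquiv

theorem subsingleton_singularHomology_of_neg (X : TopCat.{0}) {i : ℤ} (hi : i < 0) :
    Subsingleton (singularHomology X i) := by
  have h := HomologicalComplex.extend_exactAt (chains X) natToInt i fun j hj ↦ by
    have : ((j : ℕ) : ℤ) = i := hj
    omega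
  exact ModuleCat.subsingleton_of_isZero h.isZero_homology

/-- Homeomorphic spaces have isomorphic singular chain complexes. -/
def singularChainsIso {X Y : Type} [TopologicalSpace X] [TopologicalSpace Y] (e : X ≃ₜ Y) :
    singularChains (.of X) ≅ singularChains (.of Y) :=
  (ComplexShape.Embedding.extendFunctor natToInt (ModuleCat.{0} ℤ)).mapIso
    (((AlgebraicTopology.singularChainComplexFunctor _).obj ZCoeff).mapIso
      (TopCat.isoOfHomeo (X := .of X) (Y := .of Y) e))

open Filter Topology ComplexConjugate

variable {n : ℕ}

/-! ### Square-integrable functions on the circle -/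

theorem volume_unitAddCircle_eq_haar :
    (volume : Measure UnitAddCircle) = AddCircle.haarAddCircle := by
  rw [AddCircle.volume_eq_smul_haarAddCircle, ENNReal.ofReal_one, one_smul]

instance : IsProbabilityMeasure (volume : Measure UnitAddCircle) := by
  rw [volume_unitAddCircle_eq_haar]
  infer_instance

/-- Completeness of the Fourier system, for functions instead of classes of functions. -/
theorem ae_eq_zero_of_fourier_eq_zero {f : UnitAddCircle → ℂ} (hf : MemLp f 2 volume)
    (h : ∀ m : ℤ, ∫ t, fourier (-m) t * f t = 0) : f =ᵐ[volume] 0 := by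
  rw [volume_unitAddCircle_eq_haar] at hf h ⊢
  have h0 : hf.toLp f = 0 := by
    refine fourierBasis.repr.injective ?_
    ext m
    rw [fourierBasis_repr, map_zero]
    change ∫ t, _ ∂_ = _
    refine Eq.trans (integral_congr_ae ?_) (h m)
    filter_upwards [hf.coeFn_toLp] with t ht
    rw [ht, smul_eq_mul]
  exact hf.coeFn_toLp.symm.trans ((Lp.eq_zero_iff_ae_eq_zero).mp h0)

theorem integral_fourier (m : ℤ) :
    ∫ t : UnitAddCircle, fourier m t = if m = 0 then 1 else 0 := by
  rw [volume_unitAddCircle_eq_haar]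
  have h := orthonormal_iff_ite.mp (orthonormal_fourier (T := 1)) 0 m
  rw [ContinuousMap.inner_toLp] at h
  simpa [eq_comm] using h

theorem memLp_coord (f : L2 n) (j : Fin n) : MemLp (fun t ↦ f t j) 2 volume :=
  (EuclideanSpace.proj (𝕜 := ℂ) j).comp_memLp f

/-- The Fourier mode `e^{2πimt}` in the `j`-th coordinate. -/
def mode (j : Fin n) (m : ℤ) : C(UnitAddCircle, Cn n) where
  toFun t := EuclideanSpace.single j (fourier m t)
  continuous_toFun := by
    refine (PiLp.continuous_toLp 2 _).comp (continuous_pi fun i ↦ ?_)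
    obtain rfl | h := eq_or_ne i j
    · simpa only [Pi.single_eq_same] using (fourier m).continuous
    · simpa [h] using continuous_const

/-- The class of a Fourier mode in `L²`. -/
def modeL2 (j : Fin n) (m : ℤ) : L2 n := ContinuousMap.toLp 2 volume ℝ (mode j m)

theorem modeL2_ae (j : Fin n) (m : ℤ) :
    ∀ᵐ t, modeL2 j m t = EuclideanSpace.single j (fourier m t) :=
  ContinuousMap.coeFn_toLp volume (mode j m)

/-- The `m`-th Fourier coefficient of the `j`-th coordinate. -/
def coef (j : Fin n) (m : ℤ) : L2 n →L[ℂ] ℂ := innerSL ℂ (modeL2 j m)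

theorem coef_eq_integral (j : Fin n) (m : ℤ) (f : L2 n) :
    coef j m f = ∫ t, fourier (-m) t * f t j := by
  rw [coef, innerSL_apply_apply, L2.inner_def]
  refine integral_congr_ae ?_
  filter_upwards [modeL2_ae j m] with t ht
  rw [ht, EuclideanSpace.inner_single_left, fourier_neg]

theorem coef_modeL2 (j j' : Fin n) (m m' : ℤ) :
    coef j m (modeL2 j' m') = if j = j' ∧ m = m' then 1 else 0 := by
  rw [coef_eq_integral]
  have h : ∀ᵐ t, fourier (-m) t * modeL2 j' m' t j =
      if j = j' then fourier (m' - m) t else 0 := by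
    filter_upwards [modeL2_ae j' m'] with t ht
    rw [ht, PiLp.single_apply]
    split_ifs
    · rw [← fourier_add]
      congr 1
      ring_nf
    · simp
  rw [integral_congr_ae h]
  split_ifs with h1 h2 h2
  · rw [integral_fourier, if_pos (by rw [h2.2, sub_self])]
  · rw [integral_fourier, if_neg fun h ↦ h2 ⟨h1, (sub_eq_zero.mp h).symm⟩]
  · exact absurd h2.1 h1
  · simp

theorem energy_eq (p : Ambient n) : energy p = 1 / 2 * ‖p.snd‖ ^ 2 := by
  rw [energy, ← real_inner_self_eq_norm_sq, L2.inner_def]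
  simp only [real_inner_self_eq_norm_sq]

/-! ### Points of the loop space -/

theorem jet_fst_ae (γ : SmoothLoop n) :
    ∀ᵐ t, γ.jet.fst t = circleMap γ.toFun γ.smooth.continuous γ.periodic t :=
  ContinuousMap.coeFn_toLp volume _

theorem jet_snd_ae (γ : SmoothLoop n) :
    ∀ᵐ t, γ.jet.snd t = circleMap (deriv γ.toFun) (γ.smooth.continuous_deriv (by simp))
      (periodic_deriv γ.periodic) t :=
  ContinuousMap.coeFn_toLp volume _

/-- A closed pointwise condition on `(γ, ∂ₜγ)` passes from smooth loops to `H¹` loops. -/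
theorem ae_mem_of_mem_loopSpace {C : Set (Cn n × Cn n)} (hC : IsClosed C)
    (h : ∀ (γ : SmoothLoop n) (s : ℝ), (γ.toFun s, deriv γ.toFun s) ∈ C)
    {p : Ambient n} (hp : p ∈ loopSpace n) : ∀ᵐ t, (p.fst t, p.snd t) ∈ C := by
  obtain ⟨x, hx, hxp⟩ := mem_closure_iff_seq_limit.mp hp
  choose γ hγ using hx
  obtain rfl : (fun k ↦ (γ k).jet) = x := funext hγ
  have h1 : Tendsto (fun k ↦ (γ k).jet.fst) atTop (𝓝 p.fst) :=
    (WithLp.continuous_fst 2 _ _).continuousAt.tendsto.comp hxp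
  have h2 : Tendsto (fun k ↦ (γ k).jet.snd) atTop (𝓝 p.snd) :=
    (WithLp.continuous_snd 2 _ _).continuousAt.tendsto.comp hxp
  -- Convergence in `L²` gives pointwise convergence of both components along a subsequence.
  obtain ⟨ns, hns, hns'⟩ := (tendstoInMeasure_of_tendsto_Lp h1).exists_seq_tendsto_ae
  obtain ⟨ms, hms, hms'⟩ :=
    (tendstoInMeasure_of_tendsto_Lp (h2.comp hns.tendsto_atTop)).exists_seq_tendsto_ae
  filter_upwards [hns', hms', ae_all_iff.mpr fun k ↦ jet_fst_ae (γ k),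
    ae_all_iff.mpr fun k ↦ jet_snd_ae (γ k)] with t h3 h4 h5 h6
  refine hC.mem_of_tendsto ((h3.comp hms.tendsto_atTop).prodMk_nhds h4) (.of_forall fun k ↦ ?_)
  simp only [Function.comp_apply, h5, h6]
  obtain ⟨s, rfl⟩ := QuotientAddGroup.mk_surjective t
  exact h _ s

theorem hasDerivAt_smoothLoop (γ : SmoothLoop n) (s : ℝ) :
    HasDerivAt γ.toFun (deriv γ.toFun s) s :=
  (γ.smooth.differentiable (by simp)).differentiableAt.hasDerivAt

theorem hasDerivAt_smoothLoop_coord (γ : SmoothLoop n) (s : ℝ) (j : Fin n) :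
    HasDerivAt (fun s ↦ γ.toFun s j) (deriv γ.toFun s j) s :=
  ((EuclideanSpace.proj (𝕜 := ℂ) j).restrictScalars ℝ).hasFDerivAt.comp_hasDerivAt s
    (hasDerivAt_smoothLoop γ s)

/-- Almost everywhere, a loop lies in the torus and its velocity is tangent to the torus. -/
theorem ae_tangent_of_mem_loopSpace {p : Ambient n} (hp : p ∈ loopSpace n) :
    ∀ᵐ t, ∀ j, ‖p.fst t j‖ = 1 ∧ (conj (p.fst t j) * p.snd t j).re = 0 := by
  refine ae_mem_of_mem_loopSpace
    (C := {x | ∀ j, ‖x.1 j‖ = 1 ∧ (conj (x.1 j) * x.2 j).re = 0}) ?_ (fun γ s j ↦ ?_) hp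
  · simp only [Set.ofPred_forall, Set.ofPred_and]
    refine isClosed_iInter fun j ↦ .inter (isClosed_eq ?_ ?_) (isClosed_eq ?_ ?_) <;> fun_prop
  · refine ⟨γ.mem_torus s j, ?_⟩
    have h1 := (hasDerivAt_smoothLoop_coord γ s j).norm_sq
    have h2 : (fun s ↦ ‖γ.toFun s j‖ ^ 2) = fun _ ↦ 1 := by
      funext s
      rw [γ.mem_torus s j, one_pow]
    rw [h2] at h1
    have h3 := h1.unique (hasDerivAt_const s (1 : ℝ))
    simpa [Complex.inner, mul_comm] using h3

/-- The second component of a point of the loop space is the weak derivative of the first. -/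
theorem coef_snd_of_mem_loopSpace {p : Ambient n} (hp : p ∈ loopSpace n) (j : Fin n) (m : ℤ) :
    coef j m p.snd = 2 * Real.pi * Complex.I * m * coef j m p.fst := by
  have hcl : IsClosed {p : Ambient n |
      coef j m p.snd = 2 * Real.pi * Complex.I * m * coef j m p.fst} :=
    isClosed_eq ((coef j m).continuous.comp (WithLp.continuous_snd 2 _ _))
      (continuous_const.mul ((coef j m).continuous.comp (WithLp.continuous_fst 2 _ _)))
  refine hcl.closure_subset_iff.mpr ?_ hp
  rintro _ ⟨γ, rfl⟩
  have key : ∀ (f : L2 n) (g : ℝ → Cn n) (hg : Continuous g) (hgp : Function.Periodic g 1),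
      (∀ᵐ t, f t = circleMap g hg hgp t) → coef j m f =
        ∫ s in (0 : ℝ)..1, Complex.exp (2 * Real.pi * Complex.I * (-m) * s) * g s j := by
    intro f g hg hgp hfg
    rw [coef_eq_integral]
    have := UnitAddCircle.intervalIntegral_preimage 0
      fun t ↦ fourier (-m) t * circleMap g hg hgp t j
    rw [zero_add] at this
    rw [integral_congr_ae (hfg.mono fun t ht ↦ by rw [ht]), ← this]
    refine intervalIntegral.integral_congr fun s _ ↦ ?_
    simp only [fourier_coe_apply]
    push_cast
    rw [div_one]
    rfl
  simp only [Set.mem_ofPred_eq]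
  rw [key _ _ _ _ (jet_fst_ae γ), key _ _ _ _ (jet_snd_ae γ), ← sub_eq_zero,
    ← intervalIntegral.integral_const_mul, ← intervalIntegral.integral_sub]
  · -- The integrand is the derivative of the periodic function `e^{-2πims} γⱼ(s)`.
    have hd : ∀ s : ℝ, HasDerivAt
        (fun s : ℝ ↦ Complex.exp (2 * Real.pi * Complex.I * (-m) * s) * γ.toFun s j)
        (Complex.exp (2 * Real.pi * Complex.I * (-m) * s) * deriv γ.toFun s j -
          2 * Real.pi * Complex.I * m *
            (Complex.exp (2 * Real.pi * Complex.I * (-m) * s) * γ.toFun s j)) s := by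
      intro s
      have h1 := ((hasDerivAt_id s).ofReal_comp.const_mul
        (2 * Real.pi * Complex.I * (-m) : ℂ)).cexp.mul (hasDerivAt_smoothLoop_coord γ s j)
      refine h1.congr_deriv ?_
      simp only [id, Complex.ofReal_one, mul_one]
      ring
    rw [intervalIntegral.integral_eq_sub_of_hasDerivAt (fun s _ ↦ hd s)]
    · have h1 : γ.toFun 1 = γ.toFun 0 := by simpa using γ.periodic 0
      have h2 : Complex.exp (2 * Real.pi * Complex.I * (-m)) = 1 :=
        Complex.exp_eq_one_iff.mpr ⟨-m, by push_cast; ring⟩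
      simp only [Complex.ofReal_one, mul_one, h1, h2, Complex.ofReal_zero, mul_zero,
        Complex.exp_zero, sub_self]
    · have := γ.smooth.continuous
      have := γ.smooth.continuous_deriv (by simp)
      exact Continuous.intervalIntegrable (by fun_prop) _ _
  · have := γ.smooth.continuous_deriv (by simp)
    exact Continuous.intervalIntegrable (by fun_prop) _ _
  · have := γ.smooth.continuous
    exact Continuous.intervalIntegrable (by fun_prop) _ _

/-! ### The tori of closed geodesics -/

/-- The function `t ↦ e^{2πi lʲ t}` in the `j`-th coordinate and zero in the others, with its
derivative. -/
def modeJet (l : Fin n → ℤ) (j : Fin n) : Ambient n :=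
  WithLp.toLp 2 (modeL2 j (l j), (2 * Real.pi * Complex.I * l j : ℂ) • modeL2 j (l j))

/-- The closed geodesic with winding vector `l` that starts at the point `z` of the torus, with its
derivative. The starting point replaces the parameter `q ∈ ℝⁿ`, which is determined only
modulo `ℤⁿ`. -/
def torusJet (l : Fin n → ℤ) (z : Torus n) : Ambient n := ∑ j, (z j : ℂ) • modeJet l j

theorem continuous_torusJet (l : Fin n → ℤ) : Continuous (torusJet l) := by
  refine continuous_finsetSum _ fun j _ ↦ ?_
  have h : Continuous fun z : Torus n ↦ (z j : ℂ) :=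
    continuous_induced_dom.comp (continuous_apply j)
  exact h.smul continuous_const

theorem torusJet_fst (l : Fin n → ℤ) (z : Torus n) :
    (torusJet l z).fst = ∑ j, (z j : ℂ) • modeL2 j (l j) := by
  refine (map_sum (WithLp.fstL 2 ℂ (L2 n) (L2 n)) _ _).trans ?_
  rfl

theorem torusJet_snd (l : Fin n → ℤ) (z : Torus n) :
    (torusJet l z).snd =
      ∑ j, (z j : ℂ) • (2 * Real.pi * Complex.I * l j : ℂ) • modeL2 j (l j) := by
  refine (map_sum (WithLp.sndL 2 ℂ (L2 n) (L2 n)) _ _).trans ?_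
  rfl

theorem coeFn_sum {ι : Type*} (f : ι → L2 n) (s : Finset ι) :
    ∀ᵐ t, (∑ i ∈ s, f i : L2 n) t = ∑ i ∈ s, f i t := by
  classical
  induction s using Finset.induction_on with
  | empty =>
    simp only [Finset.sum_empty]
    exact Lp.coeFn_zero ..
  | insert i s hi ih =>
    rw [Finset.sum_insert hi]
    filter_upwards [ih, Lp.coeFn_add (f i) (∑ i ∈ s, f i)] with t h1 h2
    rw [h2, Pi.add_apply, h1, Finset.sum_insert hi]

theorem sum_smul_modeL2_ae (l : Fin n → ℤ) (c : Fin n → ℂ) :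
    ∀ᵐ t, ∀ j, (∑ i, c i • modeL2 i (l i) : L2 n) t j = c j * fourier (l j) t := by
  have h1 := coeFn_sum (fun i ↦ c i • modeL2 i (l i)) Finset.univ
  have h2 : ∀ᵐ t, ∀ i, (c i • modeL2 i (l i) : L2 n) t = c i • modeL2 i (l i) t :=
    ae_all_iff.mpr fun i ↦ Lp.coeFn_smul _ _
  filter_upwards [h1, h2, ae_all_iff.mpr fun i ↦ modeL2_ae i (l i)] with t h1 h2 h3 j
  rw [h1]
  simp [h2, h3, Pi.single_apply]

theorem torusJet_fst_ae (l : Fin n → ℤ) (z : Torus n) :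
    ∀ᵐ t, ∀ j, (torusJet l z).fst t j = z j * fourier (l j) t := by
  rw [torusJet_fst]
  exact sum_smul_modeL2_ae l _

theorem torusJet_snd_ae (l : Fin n → ℤ) (z : Torus n) :
    ∀ᵐ t, ∀ j, (torusJet l z).snd t j =
      2 * Real.pi * Complex.I * l j * (z j * fourier (l j) t) := by
  rw [torusJet_snd]
  simp only [smul_smul]
  filter_upwards [sum_smul_modeL2_ae l fun j ↦ (z j : ℂ) * (2 * Real.pi * Complex.I * l j)]
    with t ht j
  rw [ht]
  ring

theorem coef_torusJet_fst (l : Fin n → ℤ) (z : Torus n) (j : Fin n) (m : ℤ) :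
    coef j m (torusJet l z).fst = if m = l j then (z j : ℂ) else 0 := by
  rw [torusJet_fst]
  simp [coef_modeL2, ite_and]

theorem torusJet_inj {l l' : Fin n → ℤ} {z z' : Torus n} (h : torusJet l z = torusJet l' z') :
    l = l' ∧ z = z' := by
  have h1 : ∀ j, l j = l' j ∧ z j = z' j := by
    intro j
    have := congrArg (fun p : Ambient n ↦ coef j (l j) p.fst) h
    simp only [coef_torusJet_fst, if_true] at this
    split_ifs at this with h2
    · exact ⟨h2, Circle.ext this⟩
    · exact absurd this (Circle.coe_ne_zero _)
  exact ⟨funext fun j ↦ (h1 j).1, funext fun j ↦ (h1 j).2⟩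

theorem ambient_ext {p p' : Ambient n} (h1 : ∀ᵐ t, ∀ j, p.fst t j = p'.fst t j)
    (h2 : ∀ᵐ t, ∀ j, p.snd t j = p'.snd t j) : p = p' := by
  refine WithLp.ofLp_injective 2 (Prod.ext (Lp.ext ?_) (Lp.ext ?_))
  · filter_upwards [h1] with t ht
    exact PiLp.ext ht
  · filter_upwards [h2] with t ht
    exact PiLp.ext ht

theorem deriv_geodesic (l : Fin n → ℤ) (q : Fin n → ℝ) (s : ℝ) (j : Fin n) :
    deriv (geodesic l q).toFun s j = 2 * Real.pi * Complex.I * l j * (geodesic l q).toFun s j := by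
  refine (hasDerivAt_smoothLoop_coord (geodesic l q) s j).unique ?_
  have h := ((((hasDerivAt_id s).ofReal_comp.const_mul (l j : ℂ)).add_const (q j : ℂ)).const_mul
    (2 * Real.pi * Complex.I)).cexp
  refine h.congr_deriv ?_
  simp only [id, Complex.ofReal_one, mul_one]
  rw [mul_comm]
  rfl

theorem geodesic_eq (l : Fin n → ℤ) (q : Fin n → ℝ) (s : ℝ) (j : Fin n) :
    (geodesic l q).toFun s j =
      Circle.exp (2 * Real.pi * q j) * fourier (l j) (s : UnitAddCircle) := by
  rw [Circle.coe_exp, fourier_coe_apply, ← Complex.exp_add]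
  refine congrArg Complex.exp ?_
  push_cast
  ring

theorem geodesic_jet (l : Fin n → ℤ) (q : Fin n → ℝ) :
    (geodesic l q).jet = torusJet l fun j ↦ Circle.exp (2 * Real.pi * q j) := by
  refine ambient_ext ?_ ?_
  · filter_upwards [jet_fst_ae (geodesic l q), torusJet_fst_ae l _] with t h1 h2 j
    obtain ⟨s, rfl⟩ := QuotientAddGroup.mk_surjective t
    rw [h1, h2]
    exact geodesic_eq l q s j
  · filter_upwards [jet_snd_ae (geodesic l q), torusJet_snd_ae l _] with t h1 h2 j
    obtain ⟨s, rfl⟩ := QuotientAddGroup.mk_surjective t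
    rw [h1, h2]
    exact (deriv_geodesic l q s j).trans (congrArg _ (geodesic_eq l q s j))

theorem G_eq_range (l : Fin n → ℤ) : G l = Set.range (torusJet l) := by
  ext p
  constructor
  · rintro ⟨q, rfl⟩
    exact ⟨_, (geodesic_jet l q).symm⟩
  · rintro ⟨z, rfl⟩
    choose θ hθ using fun j ↦ Circle.exp_surjective (z j)
    refine ⟨fun j ↦ θ j / (2 * Real.pi), (geodesic_jet l _).trans (congrArg _ ?_)⟩
    funext j
    rw [mul_div_cancel₀ _ (by positivity), hθ]

theorem torusJet_mem_loopSpace (l : Fin n → ℤ) (z : Torus n) : torusJet l z ∈ loopSpace n := by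
  have : torusJet l z ∈ G l := by
    rw [G_eq_range]
    exact ⟨z, rfl⟩
  obtain ⟨q, hq⟩ := this
  exact subset_closure ⟨_, hq⟩

theorem G_disjoint {l l' : Fin n → ℤ} (h : l ≠ l') : Disjoint (G l) (G l') := by
  rw [Set.disjoint_left, G_eq_range, G_eq_range]
  rintro _ ⟨z, rfl⟩ ⟨z', hz⟩
  exact h (torusJet_inj hz).1.symm

theorem energy_torusJet (l : Fin n → ℤ) (z : Torus n) :
    energy (torusJet l z) = 2 * Real.pi ^ 2 * latticeNorm l ^ 2 := by
  rw [energy, latticeNorm, Real.sq_sqrt (by positivity)]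
  have h : ∀ᵐ t, ‖(torusJet l z).snd t‖ ^ 2 = 4 * Real.pi ^ 2 * ∑ j, (l j : ℝ) ^ 2 := by
    filter_upwards [torusJet_snd_ae l z] with t ht
    rw [EuclideanSpace.norm_sq_eq, Finset.mul_sum]
    refine Finset.sum_congr rfl fun j _ ↦ ?_
    rw [ht]
    simp only [norm_mul, Complex.norm_I, Complex.norm_intCast, Complex.norm_real,
      Circle.norm_coe, fourier_apply, mul_pow, Complex.norm_ofNat, Real.norm_eq_abs, sq_abs]
    ring
  rw [integral_congr_ae h, integral_const, probReal_univ, one_smul]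
  ring

/-! ### Closed geodesics are critical -/

theorem inner_eq_sum_integral (f g : L2 n) :
    inner ℝ f g = ∑ j, (∫ t, conj (f t j) * g t j).re := by
  have hint : ∀ j, Integrable (fun t ↦ conj (f t j) * g t j) := fun j ↦
    MemLp.integrable_mul (p := 2) (q := 2) (memLp_coord f j).star (memLp_coord g j)
  rw [L2.inner_def, ← Complex.re_sum, ← integral_finsetSum _ fun j _ ↦ hint j,
    ← RCLike.re_eq_complex_re, ← integral_re (integrable_finsetSum _ fun j _ ↦ hint j)]
  refine integral_congr_ae (.of_forall fun t ↦ ?_)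
  simp only [map_sum]
  rw [PiLp.inner_apply]
  refine Finset.sum_congr rfl fun j _ ↦ ?_
  rw [Complex.inner, mul_comm]
  rfl

theorem integral_norm_coord_sq_le (f : L2 n) (j : Fin n) : ∫ t, ‖f t j‖ ^ 2 ≤ ‖f‖ ^ 2 := by
  rw [← real_inner_self_eq_norm_sq, L2.inner_def]
  simp only [real_inner_self_eq_norm_sq]
  refine integral_mono ((memLp_coord f j).integrable_norm_pow (by simp))
    ((Lp.memLp f).integrable_norm_pow (by simp)) fun t ↦ ?_
  exact pow_le_pow_left₀ (norm_nonneg _) (PiLp.norm_apply_le _ j) 2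

/-- The first-order term of the energy at a closed geodesic is of second order along the loop
space: integrating by parts, only the `L²` pairing of `γ` with the difference of the two loops
is left, and two unit vectors `a`, `b` satisfy `2 Re (ā (b - a)) = -|b - a|²`. -/
theorem abs_inner_torusJet_le (l : Fin n → ℤ) (z : Torus n) {p : Ambient n}
    (hp : p ∈ loopSpace n) :
    |inner ℝ (torusJet l z).snd (p.snd - (torusJet l z).snd)| ≤
      2 * Real.pi ^ 2 * (∑ j, (l j : ℝ) ^ 2) * ‖p.fst - (torusJet l z).fst‖ ^ 2 := by
  set p₀ := torusJet l z with hp₀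
  have hp₀' : p₀ ∈ loopSpace n := torusJet_mem_loopSpace l z
  have key : ∀ j, (∫ t, conj (p₀.snd t j) * (p.snd - p₀.snd) t j).re =
      -(2 * Real.pi ^ 2 * (l j : ℝ) ^ 2 * ∫ t, ‖(p.fst - p₀.fst) t j‖ ^ 2) := by
    intro j
    have h1 : ∫ t, conj (p₀.snd t j) * (p.snd - p₀.snd) t j =
        conj (2 * Real.pi * Complex.I * l j * z j) * coef j (l j) (p.snd - p₀.snd) := by
      rw [coef_eq_integral, ← integral_const_mul]
      refine integral_congr_ae ?_
      filter_upwards [torusJet_snd_ae l z] with t ht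
      rw [ht, fourier_neg]
      simp only [map_mul]
      ring
    -- Integration by parts, for both loops.
    have h2 : coef j (l j) (p.snd - p₀.snd) =
        2 * Real.pi * Complex.I * l j * coef j (l j) (p.fst - p₀.fst) := by
      rw [map_sub, map_sub, coef_snd_of_mem_loopSpace hp, coef_snd_of_mem_loopSpace hp₀', mul_sub]
    have h3 : conj (z j : ℂ) * coef j (l j) (p.fst - p₀.fst) =
        ∫ t, conj (p₀.fst t j) * (p.fst - p₀.fst) t j := by
      rw [coef_eq_integral, ← integral_const_mul]
      refine integral_congr_ae ?_
      filter_upwards [torusJet_fst_ae l z] with t ht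
      rw [ht, fourier_neg]
      simp only [map_mul]
      ring
    -- `Re (ā (b - a)) = -½ |b - a|²` for unit complex numbers `a`, `b`.
    have h4 : (∫ t, conj (p₀.fst t j) * (p.fst - p₀.fst) t j).re =
        -(1 / 2) * ∫ t, ‖(p.fst - p₀.fst) t j‖ ^ 2 := by
      rw [← RCLike.re_eq_complex_re, ← integral_re, ← integral_const_mul]
      · refine integral_congr_ae ?_
        filter_upwards [ae_tangent_of_mem_loopSpace hp, ae_tangent_of_mem_loopSpace hp₀',
          Lp.coeFn_sub p.fst p₀.fst] with t h5 h6 h7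
        rw [h7]
        have h5 := (h5 j).1
        have h6 := (h6 j).1
        generalize hx : p.fst t j = x at h5
        generalize hy : p₀.fst t j = y at h6
        have hxy : (p.fst t - p₀.fst t) j = x - y := by rw [← hx, ← hy]; rfl
        simp only [Pi.sub_apply, hxy]
        rw [← sq_eq_sq₀ (norm_nonneg _) zero_le_one, Complex.sq_norm, Complex.normSq_apply]
          at h5 h6
        rw [Complex.sq_norm, Complex.normSq_apply]
        simp
        linarith
      · exact MemLp.integrable_mul (p := 2) (q := 2) (memLp_coord _ j).star (memLp_coord _ j)
    have h5 : conj (2 * Real.pi * Complex.I * l j * z j : ℂ) *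
          (2 * Real.pi * Complex.I * l j * coef j (l j) (p.fst - p₀.fst)) =
        ((4 * Real.pi ^ 2 * (l j : ℝ) ^ 2 : ℝ) : ℂ) *
          (conj (z j : ℂ) * coef j (l j) (p.fst - p₀.fst)) := by
      simp only [map_mul, Complex.conj_I, Complex.conj_ofReal, map_ofNat, map_intCast]
      push_cast
      linear_combination (-4 * Real.pi ^ 2 * (l j : ℂ) ^ 2 *
          (conj (z j : ℂ) * coef j (l j) (p.fst - p₀.fst))) * Complex.I_sq
    rw [h1, h2, h5, h3, Complex.re_ofReal_mul, h4]
    ring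
  rw [inner_eq_sum_integral, Finset.sum_congr rfl fun j _ ↦ key j, Finset.sum_neg_distrib, abs_neg,
    abs_of_nonneg (Finset.sum_nonneg fun j _ ↦ mul_nonneg (by positivity)
      (integral_nonneg fun t ↦ by positivity)), Finset.mul_sum, Finset.sum_mul]
  exact Finset.sum_le_sum fun j _ ↦
    mul_le_mul_of_nonneg_left (integral_norm_coord_sq_le _ j) (by positivity)

theorem torusJet_mem_crit (l : Fin n → ℤ) (z : Torus n) : torusJet l z ∈ crit n := by
  refine ⟨torusJet_mem_loopSpace l z, .of_isLittleO ?_⟩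
  set p₀ := torusJet l z with hp₀
  set K : ℝ := 1 / 2 + 2 * Real.pi ^ 2 * (∑ j, (l j : ℝ) ^ 2) with hK
  -- On the whole loop space the energy differs from its value at `p₀` by `O(‖p - p₀‖²)`.
  have hbound : ∀ p ∈ loopSpace n, |energy p - energy p₀| ≤ K * ‖p - p₀‖ ^ 2 := by
    intro p hp
    have h1 : energy p - energy p₀ =
        1 / 2 * ‖p.snd - p₀.snd‖ ^ 2 + inner ℝ p₀.snd (p.snd - p₀.snd) := by
      rw [energy_eq, energy_eq, inner_sub_right, real_inner_self_eq_norm_sq, norm_sub_sq_real,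
        real_inner_comm]
      ring
    have h2 := abs_inner_torusJet_le l z hp
    have h3 := WithLp.prod_norm_sq_eq_of_L2 (p - p₀)
    rw [WithLp.sub_fst, WithLp.sub_snd] at h3
    rw [h1, h3, hK]
    refine (abs_add_le _ _).trans ?_
    rw [abs_of_nonneg (by positivity : (0 : ℝ) ≤ 1 / 2 * ‖p.snd - p₀.snd‖ ^ 2)]
    have h4 : (0 : ℝ) ≤ 2 * Real.pi ^ 2 * (∑ j, (l j : ℝ) ^ 2) := by positivity
    nlinarith [sq_nonneg ‖p.fst - p₀.fst‖, mul_nonneg h4 (sq_nonneg ‖p.snd - p₀.snd‖)]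
  have hO : (fun p ↦ energy p - energy p₀) =O[𝓝[loopSpace n] p₀] fun p ↦ ‖p - p₀‖ ^ 2 := by
    refine Asymptotics.IsBigO.of_bound K ?_
    filter_upwards [self_mem_nhdsWithin] with p hp
    rw [Real.norm_eq_abs, Real.norm_of_nonneg (by positivity)]
    exact hbound p hp
  have ho : (fun p : Ambient n ↦ ‖p - p₀‖ ^ 2) =o[𝓝[loopSpace n] p₀] fun p ↦ p - p₀ :=
    (Asymptotics.isLittleO_pow_sub_sub p₀ one_lt_two).mono nhdsWithin_le_nhds
  simpa using hO.trans_isLittleO ho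

/-! ### Coordinatewise multiplication -/

/-- The coordinatewise product on `ℂⁿ`. -/
def coordMul (a x : Cn n) : Cn n := WithLp.toLp 2 fun j ↦ a j * x j

@[simp]
theorem coordMul_apply (a x : Cn n) (j : Fin n) : coordMul a x j = a j * x j := rfl

theorem continuous_coordMul {X : Type*} [TopologicalSpace X] {f g : X → Cn n} (hf : Continuous f)
    (hg : Continuous g) : Continuous fun x ↦ coordMul (f x) (g x) := by
  refine (PiLp.continuous_toLp 2 _).comp (continuous_pi fun j ↦ ?_)
  fun_prop

theorem norm_coordMul_le {c : ℝ} {a : Cn n} (h : ∀ j, ‖a j‖ ≤ c) (x : Cn n) :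
    ‖coordMul a x‖ ≤ |c| * ‖x‖ := by
  rw [← sq_le_sq₀ (norm_nonneg _) (by positivity), mul_pow, EuclideanSpace.norm_sq_eq,
    EuclideanSpace.norm_sq_eq, Finset.mul_sum]
  refine Finset.sum_le_sum fun j _ ↦ ?_
  rw [coordMul_apply, norm_mul, mul_pow]
  gcongr
  exact (h j).trans (le_abs_self c)

theorem norm_coordMul_eq {a : Cn n} (h : ∀ j, ‖a j‖ = 1) (x : Cn n) :
    ‖coordMul a x‖ = ‖x‖ := by
  rw [← sq_eq_sq₀ (norm_nonneg _) (norm_nonneg _), EuclideanSpace.norm_sq_eq,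
    EuclideanSpace.norm_sq_eq]
  simp [h]

theorem norm_coordMul_continuousMap_le (A : C(UnitAddCircle, Cn n)) (t : UnitAddCircle)
    (x : Cn n) : ‖coordMul (A t) x‖ ≤ ‖A‖ * ‖x‖ := by
  have := norm_coordMul_le (fun j ↦ (PiLp.norm_apply_le (A t) j).trans (A.norm_coe_le_norm t)) x
  rwa [abs_of_nonneg (norm_nonneg _)] at this

theorem memLp_coordMul (A : C(UnitAddCircle, Cn n)) (f : L2 n) :
    MemLp (fun t ↦ coordMul (A t) (f t)) 2 volume := by
  refine (Lp.memLp f).of_le_mul (c := ‖A‖) ?_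
    (.of_forall fun t ↦ norm_coordMul_continuousMap_le A t _)
  have hc : Continuous fun x : Cn n × Cn n ↦ coordMul x.1 x.2 :=
    continuous_coordMul continuous_fst continuous_snd
  exact hc.comp_aestronglyMeasurable
    (A.continuous.aestronglyMeasurable.prodMk (Lp.aestronglyMeasurable f))

/-- Multiplication of `L²` functions by a continuous function, coordinate by coordinate. -/
def mulOp (A : C(UnitAddCircle, Cn n)) : L2 n →L[ℂ] L2 n :=
  LinearMap.mkContinuous
    { toFun := fun f ↦ (memLp_coordMul A f).toLp _
      map_add' := fun f g ↦ by
        rw [← MemLp.toLp_add]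
        refine (MemLp.toLp_eq_toLp_iff _ _).mpr ?_
        filter_upwards [Lp.coeFn_add f g] with t ht
        ext j
        rw [ht]
        exact mul_add _ _ _
      map_smul' := fun c f ↦ by
        rw [RingHom.id_apply, ← MemLp.toLp_const_smul]
        refine (MemLp.toLp_eq_toLp_iff _ _).mpr ?_
        filter_upwards [Lp.coeFn_smul c f] with t ht
        ext j
        rw [ht]
        exact mul_left_comm _ _ _ }
    ‖A‖ fun f ↦ by
      refine Lp.norm_le_mul_norm_of_ae_le_mul ?_
      filter_upwards [(memLp_coordMul A f).coeFn_toLp] with t ht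
      exact ht ▸ norm_coordMul_continuousMap_le A t _

theorem mulOp_ae (A : C(UnitAddCircle, Cn n)) (f : L2 n) :
    ∀ᵐ t, mulOp A f t = coordMul (A t) (f t) :=
  (memLp_coordMul A f).coeFn_toLp

/-! ### The torus acts on the loop space by smooth loops -/

/-- The product of two smooth loops in the group `Tⁿ`. -/
def SmoothLoop.mul (b γ : SmoothLoop n) : SmoothLoop n where
  toFun s := coordMul (b.toFun s) (γ.toFun s)
  smooth := by
    have hb := (contDiff_piLp 2).mp b.smooth
    have hγ := (contDiff_piLp 2).mp γ.smooth
    exact (contDiff_piLp 2).mpr fun j ↦ (hb j).mul (hγ j)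
  periodic s := by
    simp only [b.periodic s, γ.periodic s]
  mem_torus s j := by
    rw [coordMul_apply, norm_mul, b.mem_torus, γ.mem_torus, one_mul]

theorem deriv_smoothLoop_mul (b γ : SmoothLoop n) (s : ℝ) (j : Fin n) :
    deriv (b.mul γ).toFun s j =
      deriv b.toFun s j * γ.toFun s j + b.toFun s j * deriv γ.toFun s j :=
  (hasDerivAt_smoothLoop_coord (b.mul γ) s j).unique
    ((hasDerivAt_smoothLoop_coord b s j).mul (hasDerivAt_smoothLoop_coord γ s j))

/-- A smooth loop, on the circle. -/
abbrev SmoothLoop.val (b : SmoothLoop n) : C(UnitAddCircle, Cn n) :=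
  circleMap b.toFun b.smooth.continuous b.periodic

/-- The derivative of a smooth loop, on the circle. -/
abbrev SmoothLoop.vel (b : SmoothLoop n) : C(UnitAddCircle, Cn n) :=
  circleMap (deriv b.toFun) (b.smooth.continuous_deriv (by simp)) (periodic_deriv b.periodic)

/-- Multiplication by a smooth loop `b` on pairs `(γ, ∂ₜγ)`: the second component is the
derivative of `bγ` given by the Leibniz rule. -/
def loopAct (b : SmoothLoop n) (p : Ambient n) : Ambient n :=
  WithLp.toLp 2 (mulOp b.val p.fst, mulOp b.vel p.fst + mulOp b.val p.snd)

theorem loopAct_mem_loopSpace (b : SmoothLoop n) {p : Ambient n} (hp : p ∈ loopSpace n) :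
    loopAct b p ∈ loopSpace n := by
  have hcont : Continuous (loopAct b) := by
    have h1 := WithLp.continuous_fst 2 (L2 n) (L2 n)
    have h2 := WithLp.continuous_snd 2 (L2 n) (L2 n)
    refine (WithLp.prod_continuous_toLp 2 _ _).comp (Continuous.prodMk ?_ ?_)
    · exact (mulOp _).continuous.comp h1
    · exact ((mulOp _).continuous.comp h1).add ((mulOp _).continuous.comp h2)
  refine map_mem_closure hcont hp ?_
  rintro _ ⟨γ, rfl⟩
  refine ⟨b.mul γ, ambient_ext ?_ ?_⟩
  · filter_upwards [jet_fst_ae (b.mul γ), mulOp_ae b.val γ.jet.fst, jet_fst_ae γ] with t h1 h2 h3 j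
    obtain ⟨s, rfl⟩ := QuotientAddGroup.mk_surjective t
    rw [h1]
    change _ = mulOp b.val γ.jet.fst _ j
    rw [h2, h3]
    rfl
  · filter_upwards [jet_snd_ae (b.mul γ), mulOp_ae b.val γ.jet.snd, mulOp_ae b.vel γ.jet.fst,
      jet_fst_ae γ, jet_snd_ae γ, Lp.coeFn_add (mulOp b.vel γ.jet.fst) (mulOp b.val γ.jet.snd)]
      with t h1 h2 h3 h4 h5 h6 j
    obtain ⟨s, rfl⟩ := QuotientAddGroup.mk_surjective t
    rw [h1]
    change _ = (mulOp b.vel γ.jet.fst + mulOp b.val γ.jet.snd : L2 n) _ j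
    rw [h6, Pi.add_apply, h2, h3, h4, h5]
    exact deriv_smoothLoop_mul b γ s j

/-! ### The first variation of the energy -/

/-- The smooth loop `t ↦ (e^{iεφ₁(t)}, …, e^{iεφₙ(t)})`. -/
def phaseLoop (φ : Fin n → ℝ → ℝ) (hφ : ∀ j, ContDiff ℝ ∞ (φ j))
    (hper : ∀ j, Function.Periodic (φ j) 1) (ε : ℝ) : SmoothLoop n where
  toFun s := WithLp.toLp 2 fun j ↦ Complex.exp (Complex.I * ((ε * φ j s : ℝ) : ℂ))
  smooth := (contDiff_piLp 2).mpr fun j ↦ (contDiff_const.mul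
    (Complex.ofRealCLM.contDiff.comp (contDiff_const.mul (hφ j)))).cexp
  periodic s := by simp only [hper _ s]
  mem_torus s j := by
    change ‖Complex.exp (Complex.I * ((ε * φ j s : ℝ) : ℂ))‖ = 1
    rw [mul_comm]
    exact Complex.norm_exp_ofReal_mul_I _

theorem deriv_phaseLoop (φ : Fin n → ℝ → ℝ) (hφ : ∀ j, ContDiff ℝ ∞ (φ j))
    (hper : ∀ j, Function.Periodic (φ j) 1) (ε s : ℝ) (j : Fin n) :
    deriv (phaseLoop φ hφ hper ε).toFun s j =
      (phaseLoop φ hφ hper ε).toFun s j * (ε * (Complex.I * (deriv (φ j) s : ℝ))) := by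
  refine (hasDerivAt_smoothLoop_coord (phaseLoop φ hφ hper ε) s j).unique ?_
  have h1 : HasDerivAt (φ j) (deriv (φ j) s) s :=
    ((hφ j).differentiable (by simp)).differentiableAt.hasDerivAt
  refine (((h1.const_mul ε).ofReal_comp).const_mul Complex.I).cexp.congr_deriv ?_
  rw [Complex.ofReal_mul ε (deriv (φ j) s), mul_left_comm Complex.I]
  rfl

/-- The function `iψ` with values in `iℝⁿ`, on the circle, for a periodic real function `ψ`. -/
def imagMap (ψ : Fin n → ℝ → ℝ) (hψ : ∀ j, Continuous (ψ j))
    (hper : ∀ j, Function.Periodic (ψ j) 1) : C(UnitAddCircle, Cn n) :=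
  circleMap (fun s ↦ WithLp.toLp 2 fun j ↦ Complex.I * (ψ j s : ℂ))
    ((PiLp.continuous_toLp 2 _).comp (continuous_pi fun j ↦
      continuous_const.mul (Complex.continuous_ofReal.comp (hψ j))))
    (fun s ↦ by simp only [hper _ s])

theorem periodic_deriv_real {f : ℝ → ℝ} (hp : Function.Periodic f 1) :
    Function.Periodic (deriv f) 1 := by
  intro t
  rw [← deriv_comp_add_const]
  congr 1
  exact funext hp

theorem norm_le_add_of_sq_eq {x a b : ℝ} (ha : 0 ≤ a) (hb : 0 ≤ b) (h : x ^ 2 = a ^ 2 + b ^ 2) :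
    x ≤ a + b := by
  nlinarith [mul_nonneg ha hb]

/-- At a critical point `(γ, v)` the derivative of the energy along `ε ↦ e^{iεφ} γ`, which is
`Re ⟨v, iφ'γ⟩`, vanishes. -/
theorem first_variation {p : Ambient n} (hp : p ∈ crit n) (φ : Fin n → ℝ → ℝ)
    (hφ : ∀ j, ContDiff ℝ ∞ (φ j)) (hper : ∀ j, Function.Periodic (φ j) 1) :
    inner ℝ p.snd (mulOp (imagMap (fun j ↦ deriv (φ j)) (fun j ↦ (hφ j).continuous_deriv (by simp))
      fun j ↦ periodic_deriv_real (hper j)) p.fst) = 0 := by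
  obtain ⟨hpL, hpd⟩ := hp
  set A := imagMap (fun j ↦ deriv (φ j)) (fun j ↦ (hφ j).continuous_deriv (by simp))
    fun j ↦ periodic_deriv_real (hper j) with hA
  set X := mulOp A p.fst with hX
  set Φ := imagMap φ (fun j ↦ (hφ j).continuous) hper with hΦ
  let b : ℝ → SmoothLoop n := phaseLoop φ hφ hper
  let c : ℝ → Ambient n := fun ε ↦ loopAct (b ε) p
  -- The velocity of `e^{iεφ} γ` is `e^{iεφ} (v + ε iφ'γ)`, and the factor `e^{iεφ}` is unitary.
  have hsnd : ∀ ε : ℝ, (c ε).snd = mulOp (b ε).val (p.snd + ε • X) := by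
    intro ε
    refine Lp.ext ?_
    filter_upwards [mulOp_ae (b ε).val (p.snd + ε • X), mulOp_ae (b ε).val p.snd,
      mulOp_ae (b ε).vel p.fst, mulOp_ae A p.fst,
      Lp.coeFn_add (mulOp (b ε).vel p.fst) (mulOp (b ε).val p.snd),
      Lp.coeFn_add p.snd (ε • X), Lp.coeFn_smul ε X] with t h1 h2 h3 h4 h5 h6 h7
    change (mulOp (b ε).vel p.fst + mulOp (b ε).val p.snd : L2 n) t = _
    rw [h5, Pi.add_apply, h3, h2, h1, h6, Pi.add_apply, h7, Pi.smul_apply, hX, h4]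
    obtain ⟨s, rfl⟩ := QuotientAddGroup.mk_surjective t
    ext j
    have hv : (b ε).vel s j = (b ε).val s j * (ε * A s j) := deriv_phaseLoop φ hφ hper ε s j
    change (b ε).vel s j * p.fst s j + (b ε).val s j * p.snd s j =
      (b ε).val s j * (p.snd s j + ε • (A s j * p.fst s j))
    rw [hv, Complex.real_smul]
    ring
  have hnorm : ∀ (ε : ℝ) (f : L2 n), ‖mulOp (b ε).val f‖ = ‖f‖ := by
    intro ε f
    rw [Lp.norm_def, Lp.norm_def]
    refine congrArg _ (eLpNorm_congr_norm_ae ?_)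
    filter_upwards [mulOp_ae (b ε).val f] with t ht
    obtain ⟨s, rfl⟩ := QuotientAddGroup.mk_surjective t
    rw [ht]
    exact norm_coordMul_eq ((b ε).mem_torus s) _
  have hdiff : ∀ (ε : ℝ) (f : L2 n), ‖mulOp (b ε).val f - f‖ ≤ |ε| * ‖Φ‖ * ‖f‖ := by
    intro ε f
    refine Lp.norm_le_mul_norm_of_ae_le_mul ?_
    filter_upwards [mulOp_ae (b ε).val f, Lp.coeFn_sub (mulOp (b ε).val f) f] with t h1 h2
    obtain ⟨s, rfl⟩ := QuotientAddGroup.mk_surjective t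
    have h3 : coordMul ((b ε).val s) (f s) - f s =
        coordMul (WithLp.toLp 2 fun j ↦ (b ε).val s j - 1) (f s) := by
      ext j
      simp [sub_mul]
    rw [h2, Pi.sub_apply, h1, h3]
    refine (norm_coordMul_le (c := |ε| * ‖Φ‖) (fun j ↦ ?_) _).trans
      (by rw [abs_of_nonneg (by positivity)])
    refine (Real.norm_exp_I_mul_ofReal_sub_one_le (x := ε * φ j s)).trans ?_
    rw [norm_mul, Real.norm_eq_abs ε]
    refine mul_le_mul_of_nonneg_left ?_ (abs_nonneg ε)
    refine le_trans (le_of_eq ?_) ((PiLp.norm_apply_le (Φ s) j).trans (Φ.norm_coe_le_norm s))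
    change _ = ‖Complex.I * (φ j s : ℂ)‖
    rw [norm_mul, Complex.norm_I, one_mul, Complex.norm_real]
  -- The curve is Lipschitz at `0`, which suffices for a differential that vanishes along the loop
  -- space to give a vanishing derivative along the curve.
  have hcO : (fun ε ↦ c ε - p) =O[𝓝 0] fun ε : ℝ ↦ ε := by
    refine Asymptotics.IsBigO.of_bound (‖Φ‖ * ‖p.fst‖ + (‖Φ‖ * (‖p.snd‖ + ‖X‖) + ‖X‖)) ?_
    filter_upwards [Metric.ball_mem_nhds (0 : ℝ) one_pos] with ε hε
    have hε1 : |ε| ≤ 1 := by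
      rw [Metric.mem_ball, dist_zero_right, Real.norm_eq_abs] at hε
      exact hε.le
    have h1 := WithLp.prod_norm_sq_eq_of_L2 (c ε - p)
    rw [WithLp.sub_fst, WithLp.sub_snd] at h1
    refine (norm_le_add_of_sq_eq (norm_nonneg _) (norm_nonneg _) h1).trans ?_
    have h2 : ‖(c ε).fst - p.fst‖ ≤ |ε| * ‖Φ‖ * ‖p.fst‖ := hdiff ε p.fst
    have h3 : ‖p.snd + ε • X‖ ≤ ‖p.snd‖ + ‖X‖ := by
      refine (norm_add_le _ _).trans ?_
      rw [norm_smul, Real.norm_eq_abs]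
      gcongr
      exact mul_le_of_le_one_left (norm_nonneg _) hε1
    have h4 : ‖(c ε).snd - p.snd‖ ≤ |ε| * ‖Φ‖ * (‖p.snd‖ + ‖X‖) + |ε| * ‖X‖ := by
      have h5 : (c ε).snd - p.snd =
          (mulOp (b ε).val (p.snd + ε • X) - (p.snd + ε • X)) + ε • X := by
        rw [hsnd]
        abel
      rw [h5]
      refine (norm_add_le _ _).trans (add_le_add ((hdiff ε _).trans ?_) ?_)
      · gcongr
      · rw [norm_smul, Real.norm_eq_abs]
    rw [Real.norm_eq_abs]
    linarith
  have hc0 : c 0 = p := by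
    have h1 := hdiff 0
    simp only [abs_zero, zero_mul] at h1
    have h2 : ∀ f, mulOp (b 0).val f = f := fun f ↦
      sub_eq_zero.mp (norm_le_zero_iff.mp (h1 f))
    refine WithLp.ofLp_injective 2 (Prod.ext (h2 _) ?_)
    have h3 := hsnd 0
    rw [zero_smul, add_zero, h2] at h3
    exact h3
  have hct : Tendsto c (𝓝 0) (𝓝[loopSpace n] p) := by
    refine tendsto_nhdsWithin_iff.mpr ⟨?_, .of_forall fun ε ↦ loopAct_mem_loopSpace _ hpL⟩
    exact tendsto_sub_nhds_zero_iff.mp (hcO.trans_tendsto tendsto_id)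
  have hE : ∀ ε : ℝ, energy (c ε) =
      1 / 2 * (‖p.snd‖ ^ 2 + 2 * ε * inner ℝ p.snd X + ε ^ 2 * ‖X‖ ^ 2) := by
    intro ε
    rw [energy_eq, hsnd, hnorm, norm_add_sq_real, real_inner_smul_right, norm_smul, mul_pow,
      Real.norm_eq_abs, sq_abs]
    ring
  have hd1 : HasDerivAt (fun ε ↦ energy (c ε)) 0 0 := by
    rw [hasDerivAt_iff_isLittleO]
    have h1 := (hpd.isLittleO.comp_tendsto hct).trans_isBigO hcO
    simpa [Function.comp_def, hc0] using h1
  have hd2 : HasDerivAt (fun ε ↦ energy (c ε)) (inner ℝ p.snd X) 0 := by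
    simp only [hE]
    have h1 := ((((hasDerivAt_id (0 : ℝ)).const_mul 2).mul_const (inner ℝ p.snd X)).const_add
      (‖p.snd‖ ^ 2)).add (((hasDerivAt_id (0 : ℝ)).pow 2).mul_const (‖X‖ ^ 2))
    refine (h1.const_mul (1 / 2 : ℝ)).congr_deriv ?_
    simp
  exact hd2.unique hd1

/-- The first variation along the rotation of a single coordinate by the phase `φ`. -/
theorem first_variation_coord {p : Ambient n} (hp : p ∈ crit n) (j : Fin n) (φ : ℝ → ℝ)
    (hφ : ContDiff ℝ ∞ φ) (hper : Function.Periodic φ 1) :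
    (∫ t, conj (p.snd t j) * (Complex.I * ((periodic_deriv_real hper).lift t : ℝ) *
      p.fst t j)).re = 0 := by
  have hφ' : ∀ i, ContDiff ℝ ∞ ((Pi.single j φ : Fin n → ℝ → ℝ) i) := by
    intro i
    obtain rfl | h := eq_or_ne i j
    · simpa using hφ
    · rw [Pi.single_eq_of_ne h]
      exact contDiff_const
  have hper' : ∀ i, Function.Periodic ((Pi.single j φ : Fin n → ℝ → ℝ) i) 1 := by
    intro i
    obtain rfl | h := eq_or_ne i j
    · simpa using hper
    · rw [Pi.single_eq_of_ne h]
      exact fun _ ↦ rfl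
  have h := first_variation hp (Pi.single j φ) hφ' hper'
  rw [inner_eq_sum_integral, Finset.sum_eq_single j] at h
  · rw [← h]
    congr 1
    refine integral_congr_ae ?_
    filter_upwards [mulOp_ae (imagMap (fun i ↦ deriv ((Pi.single j φ : Fin n → ℝ → ℝ) i))
      (fun i ↦ (hφ' i).continuous_deriv (by simp)) fun i ↦ periodic_deriv_real (hper' i)) p.fst]
      with t ht
    obtain ⟨s, rfl⟩ := QuotientAddGroup.mk_surjective t
    rw [ht]
    change _ = _ * (Complex.I * (deriv ((Pi.single j φ : Fin n → ℝ → ℝ) j) s : ℝ) * _)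
    rw [Pi.single_eq_same]
    rfl
  · intro i _ hi
    rw [integral_eq_zero_of_ae, Complex.zero_re]
    filter_upwards [mulOp_ae (imagMap (fun i ↦ deriv ((Pi.single j φ : Fin n → ℝ → ℝ) i))
      (fun i ↦ (hφ' i).continuous_deriv (by simp)) fun i ↦ periodic_deriv_real (hper' i)) p.fst]
      with t ht
    obtain ⟨s, rfl⟩ := QuotientAddGroup.mk_surjective t
    rw [ht]
    change _ * (Complex.I * (deriv ((Pi.single j φ : Fin n → ℝ → ℝ) i) s : ℝ) * _) = 0
    have h0 : deriv (0 : ℝ → ℝ) s = 0 := deriv_const s (0 : ℝ)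
    rw [Pi.single_eq_of_ne hi, h0]
    simp
  · exact fun h ↦ absurd (Finset.mem_univ j) h

/-! ### Critical points are closed geodesics -/

/-- The angular velocity `v̄ⱼ i γⱼ` of the `j`-th coordinate of a point `(γ, v)`. It is
complex-valued by definition, and real almost everywhere for points of the loop space, where
`|γⱼ| = 1` and `vⱼ ∈ ℝ i γⱼ`. -/
def angularVelocity (p : Ambient n) (j : Fin n) (t : UnitAddCircle) : ℂ :=
  conj (p.snd t j) * (Complex.I * p.fst t j)

theorem angularVelocity_im_ae {p : Ambient n} (hp : p ∈ loopSpace n) (j : Fin n) :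
    ∀ᵐ t, (angularVelocity p j t).im = 0 := by
  filter_upwards [ae_tangent_of_mem_loopSpace hp] with t ht
  have := (ht j).2
  simp only [angularVelocity, Complex.mul_im, Complex.mul_re, Complex.conj_re, Complex.conj_im,
    Complex.I_re, Complex.I_im] at this ⊢
  linarith

theorem memLp_angularVelocity {p : Ambient n} (hp : p ∈ loopSpace n) (j : Fin n) :
    MemLp (angularVelocity p j) 2 volume := by
  refine (memLp_coord p.snd j).of_le_mul (c := 1) ?_ ?_
  · exact (memLp_coord p.snd j).star.aestronglyMeasurable.mul
      ((memLp_coord p.fst j).aestronglyMeasurable.const_mul Complex.I)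
  · filter_upwards [ae_tangent_of_mem_loopSpace hp] with t ht
    simp [angularVelocity, (ht j).1]

theorem integrable_fourier_mul {f : UnitAddCircle → ℂ} (hf : MemLp f 2 volume) (m : ℤ) :
    Integrable (fun t ↦ fourier m t * f t) :=
  MemLp.integrable_mul (p := 2) (q := 2)
    ((fourier m).continuous.memLp_of_hasCompactSupport (HasCompactSupport.of_compactSpace _)) hf

/-- The variations with `φ' = Re (η e^{-2πimt})` for `η ∈ ℂ` detect the `m`-th Fourier coefficient
of the angular velocity of a critical point; `m ≠ 0` is what makes `φ` periodic. -/
theorem integral_fourier_angularVelocity {p : Ambient n} (hp : p ∈ crit n) (j : Fin n) {m : ℤ}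
    (hm : m ≠ 0) : ∫ t, fourier (-m) t * angularVelocity p j t = 0 := by
  set J := ∫ t, fourier (-m) t * angularVelocity p j t with hJ
  set a : ℂ := 2 * Real.pi * Complex.I * (-m) with ha
  have ha0 : a ≠ 0 := by
    simp [ha, Real.pi_ne_zero, hm]
  -- This choice of `η` turns the first variation `Re (η J) = 0` into `|J|² = 0`.
  let η : ℂ := conj J
  let φ : ℝ → ℝ := fun s ↦ (η / a * Complex.exp (a * s)).re
  have hexp : ∀ s : ℝ, Complex.exp (a * s) = fourier (-m) (s : UnitAddCircle) := by
    intro s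
    rw [fourier_coe_apply, ha]
    push_cast
    rw [div_one]
  have hφ : ContDiff ℝ ∞ φ := Complex.reCLM.contDiff.comp
    (contDiff_const.mul (contDiff_const.mul Complex.ofRealCLM.contDiff).cexp)
  have hper : Function.Periodic φ 1 := by
    intro s
    simp only [φ, hexp, AddCircle.coe_add_period]
  have hderiv : ∀ s : ℝ, deriv φ s = (η * fourier (-m) (s : UnitAddCircle)).re := by
    intro s
    have h1 := (((hasDerivAt_id s).ofReal_comp.const_mul a).cexp.const_mul (η / a))
    have h2 : HasDerivAt φ _ s := Complex.reCLM.hasFDerivAt.comp_hasDerivAt s h1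
    rw [h2.deriv, ← hexp]
    simp only [id, Complex.ofReal_one, mul_one, Complex.reCLM_apply]
    congr 1
    field_simp
  have h := first_variation_coord hp j φ hφ hper
  have hre : (∫ t, conj (p.snd t j) * (Complex.I * ((periodic_deriv_real hper).lift t : ℝ) *
      p.fst t j)).re = (η * J).re := by
    rw [hJ, ← integral_const_mul, ← RCLike.re_eq_complex_re]
    have hW := memLp_angularVelocity hp.1 j
    have hint := (integrable_fourier_mul hW (-m)).const_mul η
    have hreal : ∀ᵐ t, conj (p.snd t j) * (Complex.I * ((periodic_deriv_real hper).lift t : ℝ) *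
        p.fst t j) = (((η * (fourier (-m) t * angularVelocity p j t)).re : ℝ) : ℂ) := by
      filter_upwards [angularVelocity_im_ae hp.1 j] with t ht
      obtain ⟨s, rfl⟩ := QuotientAddGroup.mk_surjective t
      change conj (p.snd s j) * (Complex.I * (deriv φ s : ℝ) * p.fst s j) = _
      rw [hderiv, ← mul_assoc η, Complex.mul_re (η * _), ht, mul_zero, sub_zero, Complex.ofReal_mul]
      have hw : angularVelocity p j s = ((angularVelocity p j s).re : ℂ) :=
        Complex.ext rfl (by simpa using ht)
      rw [← hw, angularVelocity]
      ring
    rw [integral_congr_ae hreal]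
    refine (congrArg RCLike.re integral_complex_ofReal).trans ?_
    exact integral_re hint
  rw [hre, mul_comm, Complex.mul_conj, Complex.ofReal_re, Complex.normSq_eq_zero] at h
  exact h

/-- A critical point of the energy rotates with constant angular velocity in every coordinate. -/
theorem exists_const_angularVelocity {p : Ambient n} (hp : p ∈ crit n) (j : Fin n) :
    ∃ c : ℂ, ∀ᵐ t, p.snd t j = Complex.I * c * p.fst t j := by
  have hW := memLp_angularVelocity hp.1 j
  set c := ∫ t, angularVelocity p j t with hc
  have h0 : ∀ᵐ t, angularVelocity p j t - c = 0 := by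
    have hmem : MemLp (fun t ↦ angularVelocity p j t - c) 2 volume := hW.sub (memLp_const c)
    refine ae_eq_zero_of_fourier_eq_zero hmem fun m ↦ ?_
    simp only [mul_sub]
    rw [integral_sub (integrable_fourier_mul hW _) (integrable_fourier_mul (memLp_const c) _),
      integral_mul_const, integral_fourier]
    obtain rfl | hm := eq_or_ne m 0
    · simp [hc]
    · rw [integral_fourier_angularVelocity hp j hm, if_neg (by simpa using hm)]
      simp
  refine ⟨conj c, ?_⟩
  filter_upwards [h0, ae_tangent_of_mem_loopSpace hp.1] with t h1 h2
  have h3 : p.fst t j * conj (p.fst t j) = 1 := by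
    rw [Complex.mul_conj, Complex.normSq_eq_norm_sq, (h2 j).1]
    simp
  rw [← sub_eq_zero.mp h1, angularVelocity]
  simp only [map_mul, Complex.conj_conj, Complex.conj_I]
  linear_combination (-p.snd t j) * h3 + (p.snd t j) * (p.fst t j * conj (p.fst t j)) *
    Complex.I_sq

/-- A loop with constant angular velocity is a single Fourier mode in each coordinate. -/
theorem exists_eq_fourier {p : Ambient n} (hp : p ∈ crit n) (j : Fin n) :
    ∃ (l : ℤ) (z : Circle), ∀ᵐ t, p.fst t j = z * fourier l t ∧
      p.snd t j = 2 * Real.pi * Complex.I * l * (z * fourier l t) := by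
  obtain ⟨c, hc⟩ := exists_const_angularVelocity hp j
  -- Compare `v = icγ` with `v̂(m) = 2πim γ̂(m)`.
  have hcoef : ∀ m : ℤ, (c - 2 * Real.pi * m) * coef j m p.fst = 0 := by
    intro m
    have h1 := coef_snd_of_mem_loopSpace hp.1 j m
    have h2 : coef j m p.snd = Complex.I * c * coef j m p.fst := by
      rw [coef_eq_integral, coef_eq_integral, ← integral_const_mul]
      refine integral_congr_ae ?_
      filter_upwards [hc] with t ht
      rw [ht]
      ring
    refine mul_left_cancel₀ Complex.I_ne_zero ?_
    linear_combination h1 - h2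
  have hne : ∃ l : ℤ, coef j l p.fst ≠ 0 := by
    by_contra! h
    have h1 := ae_eq_zero_of_fourier_eq_zero (memLp_coord p.fst j) fun m ↦
      (coef_eq_integral j m p.fst).symm.trans (h m)
    obtain ⟨t, h2, h3⟩ := (h1.and (ae_tangent_of_mem_loopSpace hp.1)).exists
    have h4 := (h3 j).1
    rw [show p.fst t j = 0 from h2, norm_zero] at h4
    exact zero_ne_one h4
  obtain ⟨l, hl⟩ := hne
  have hcl : c = 2 * Real.pi * l :=
    sub_eq_zero.mp ((mul_eq_zero.mp (hcoef l)).resolve_right hl)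
  have hzero : ∀ m : ℤ, m ≠ l → coef j m p.fst = 0 := by
    intro m hm
    refine (mul_eq_zero.mp (hcoef m)).resolve_left ?_
    rw [hcl, ← mul_sub]
    refine mul_ne_zero (by simp [Real.pi_ne_zero]) (sub_ne_zero.mpr ?_)
    exact_mod_cast hm.symm
  set z := coef j l p.fst with hz
  have hfst : ∀ᵐ t, p.fst t j = z * fourier l t := by
    have hmem : MemLp (fun t ↦ fourier l t * z) 2 (volume : Measure UnitAddCircle) :=
      ((fourier l).continuous.mul continuous_const).memLp_of_hasCompactSupport
        (HasCompactSupport.of_compactSpace _)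
    have hmem' : MemLp (fun t ↦ p.fst t j - fourier l t * z) 2 volume :=
      (memLp_coord p.fst j).sub hmem
    have h1 := ae_eq_zero_of_fourier_eq_zero hmem' fun m ↦ by
      have h2 : ∀ t : UnitAddCircle, fourier (-m) t * (p.fst t j - fourier l t * z) =
          fourier (-m) t * p.fst t j - fourier (l - m) t * z := by
        intro t
        rw [sub_eq_neg_add l m, fourier_add, mul_assoc, mul_sub]
      simp only [h2]
      rw [integral_sub (integrable_fourier_mul (memLp_coord p.fst j) _)
        (integrable_fourier_mul (memLp_const z) _), integral_mul_const, integral_fourier,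
        ← coef_eq_integral]
      obtain rfl | hm := eq_or_ne m l
      · simp [hz]
      · rw [hzero m hm, if_neg (sub_ne_zero.mpr hm.symm)]
        simp
    filter_upwards [h1] with t ht
    rw [mul_comm]
    exact sub_eq_zero.mp ht
  -- Only the mode `l` survives, and `|γⱼ| = 1` forces its coefficient to be a unit.
  have hznorm : ‖z‖ = 1 := by
    obtain ⟨t, h2, h3⟩ := (hfst.and (ae_tangent_of_mem_loopSpace hp.1)).exists
    have h4 := (h3 j).1
    rwa [h2, norm_mul, fourier_apply, Circle.norm_coe, mul_one] at h4
  refine ⟨l, ⟨z, mem_sphere_zero_iff_norm.mpr hznorm⟩, ?_⟩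
  filter_upwards [hfst, hc] with t h1 h2
  refine ⟨h1, ?_⟩
  rw [h2, h1, hcl]
  change Complex.I * (2 * Real.pi * l) * (z * _) = 2 * Real.pi * Complex.I * l * (z * _)
  ring

/-- The critical points of the energy are exactly the closed geodesics. -/
theorem mem_crit_iff {p : Ambient n} : p ∈ crit n ↔ ∃ l z, torusJet l z = p := by
  constructor
  · intro hp
    choose l z h using exists_eq_fourier hp
    refine ⟨l, z, ambient_ext ?_ ?_⟩
    · filter_upwards [torusJet_fst_ae l z, ae_all_iff.mpr h] with t h1 h2 j
      rw [h1, (h2 j).1]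
    · filter_upwards [torusJet_snd_ae l z, ae_all_iff.mpr h] with t h1 h2 j
      rw [h1, (h2 j).2]
  · rintro ⟨l, z, rfl⟩
    exact torusJet_mem_crit l z

theorem energy_torusJet_le_iff (l k : Fin n → ℤ) (z : Torus n) :
    energy (torusJet l z) ≤ 2 * Real.pi ^ 2 * latticeNorm k ^ 2 ↔
      latticeNorm l ≤ latticeNorm k := by
  rw [energy_torusJet, mul_le_mul_iff_right₀ (by positivity),
    sq_le_sq₀ (show 0 ≤ latticeNorm l from Real.sqrt_nonneg _)
      (show 0 ≤ latticeNorm k from Real.sqrt_nonneg _)]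

theorem critBelow_eq_iUnion (k : Fin n → ℤ) :
    critBelow n (2 * Real.pi ^ 2 * latticeNorm k ^ 2) = ⋃ l : LatticeBall k, G l.1 := by
  ext p
  simp only [Set.mem_iUnion, G_eq_range]
  constructor
  · rintro ⟨hp, hE⟩
    obtain ⟨l, z, rfl⟩ := mem_crit_iff.mp hp
    exact ⟨⟨l, (energy_torusJet_le_iff l k z).mp hE⟩, z, rfl⟩
  · rintro ⟨⟨l, hl⟩, z, rfl⟩
    exact ⟨torusJet_mem_crit l z, (energy_torusJet_le_iff l k z).mpr hl⟩

/-! ### The topology of the critical set -/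

instance (k : Fin n → ℤ) : Finite (LatticeBall k) := by
  obtain ⟨N, hN⟩ := exists_nat_ge (latticeNorm k)
  have hsub : {l : Fin n → ℤ | latticeNorm l ≤ latticeNorm k} ⊆
      Set.Icc (fun _ ↦ -(N : ℤ)) fun _ ↦ N := by
    intro l hl
    have h : ∀ j, |l j| ≤ (N : ℤ) := by
      intro j
      have h1 : |(l j : ℝ)| ≤ latticeNorm l := Real.abs_le_sqrt
        (Finset.single_le_sum (f := fun j ↦ (l j : ℝ) ^ 2) (fun i _ ↦ sq_nonneg _)
          (Finset.mem_univ j))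
      have h2 : |(l j : ℝ)| ≤ N := h1.trans (le_trans hl hN)
      exact_mod_cast h2
    exact ⟨fun j ↦ (abs_le.mp (h j)).1, fun j ↦ (abs_le.mp (h j)).2⟩
  exact ((Set.finite_Icc _ _).subset hsub).to_subtype

instance (l : Fin n → ℤ) : CompactSpace (G l) := by
  rw [G_eq_range]
  exact isCompact_iff_compactSpace.mp (isCompact_range (continuous_torusJet l))

/-- The critical set is the topological disjoint union of its finitely many compact pieces. -/
theorem nonempty_sigma_G_homeomorph (k : Fin n → ℤ) {a : ℝ}
    (ha : a = 2 * Real.pi ^ 2 * latticeNorm k ^ 2) :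
    Nonempty ((Σ l : LatticeBall k, G l.1) ≃ₜ critBelow n a) := by
  subst ha
  have hU := critBelow_eq_iUnion k
  let f : (Σ l : LatticeBall k, G l.1) → critBelow n (2 * Real.pi ^ 2 * latticeNorm k ^ 2) :=
    fun x ↦ ⟨x.2.1, hU ▸ Set.mem_iUnion.mpr ⟨x.1, x.2.2⟩⟩
  have hf : Continuous f := by
    refine continuous_sigma fun l ↦ ?_
    exact Continuous.subtype_mk continuous_subtype_val _
  have hbij : Function.Bijective f := by
    constructor
    · rintro ⟨l, x⟩ ⟨l', x'⟩ h
      have hx : x.1 = x'.1 := congrArg Subtype.val h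
      obtain rfl : l = l' := by
        by_contra hl
        exact (Set.disjoint_left.mp (G_disjoint fun h ↦ hl (Subtype.ext h)) x.2) (hx ▸ x'.2)
      rw [Subtype.ext hx]
    · rintro ⟨p, hp⟩
      obtain ⟨l, hl⟩ := Set.mem_iUnion.mp (hU ▸ hp)
      exact ⟨⟨l, p, hl⟩, rfl⟩
  exact ⟨Continuous.homeoOfEquivCompactToT2 (f := .ofBijective f hbij) hf⟩

/-- Every piece `Gˡ` is a torus. -/
def torusHomeomorphG (l : Fin n → ℤ) : Torus n ≃ₜ G l :=
  (Continuous.homeoOfEquivCompactToT2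
    (f := .ofInjective (torusJet l) fun _ _ h ↦ (torusJet_inj h).2)
    ((continuous_torusJet l).subtype_mk _)).trans (.setCongr (G_eq_range l).symm)

theorem nonempty_prod_torus_homeomorph (k : Fin n → ℤ) :
    Nonempty (LatticeBall k × Torus n ≃ₜ Σ _ : LatticeBall k, Torus n) := by
  have hc : Continuous (Equiv.sigmaEquivProd (LatticeBall k) (Torus n)) :=
    continuous_sigma fun l ↦ .prodMk continuous_const continuous_id
  exact ⟨hc.homeoOfEquivCompactToT2.symm⟩

theorem nonempty_sigma_torus_homeomorph (k : Fin n → ℤ) {a : ℝ}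
    (ha : a = 2 * Real.pi ^ 2 * latticeNorm k ^ 2) :
    Nonempty ((Σ _ : LatticeBall k, Torus n) ≃ₜ critBelow n a) := by
  obtain ⟨e⟩ := nonempty_sigma_G_homeomorph k ha
  let f : (Σ _ : LatticeBall k, Torus n) ≃ Σ l : LatticeBall k, G l.1 :=
    Equiv.sigmaCongrRight fun l ↦ (torusHomeomorphG l.1).toEquiv
  have hf : Continuous f := continuous_sigma fun l ↦
    continuous_sigmaMk.comp (torusHomeomorphG l.1).continuous
  exact ⟨(Continuous.homeoOfEquivCompactToT2 (f := f) hf).trans e⟩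

/-! ### The Bott-type Morse homology -/

theorem isFreeOfRank_HM (k : Fin n → ℤ) {a : ℝ}
    (ha : a = 2 * Real.pi ^ 2 * latticeNorm k ^ 2) (i : ℕ) :
    IsFreeOfRank (HM n a i) (Nat.card (LatticeBall k) * n.choose i) := by
  obtain ⟨e⟩ := nonempty_sigma_torus_homeomorph k ha
  obtain ⟨e'⟩ := nonempty_prod_torus_homeomorph k
  exact ((isFreeOfRank_homology_prod_torus (LatticeBall k) n i).homology_congr
    (e'.trans e)).congr (singularHomologyNatEquiv _ i).symm.toAddEquiv

theorem isFreeOfRank_directSum (I : Type) [Finite I] (r : ℕ) :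
    IsFreeOfRank (⨁ _ : I, (Fin r → ℤ)) (Nat.card I * r) := by
  have := Fintype.ofFinite I
  exact ⟨inferInstance, inferInstance, by simp [Module.finrank_directSum]⟩

theorem subsingleton_of_isFreeOfRank_zero {M : Type*} [AddCommGroup M] (h : IsFreeOfRank M 0) :
    Subsingleton M := by
  obtain ⟨h1, h2, h3⟩ := h
  exact Module.finrank_zero_iff.mp h3

end

end BottMorse

theorem mainTheorem2 (n : ℕ) (k : Fin n → ℤ) (a : ℝ)
    (ha : a = 2 * Real.pi ^ 2 * BottMorse.latticeNorm k ^ 2) :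
    -- `Critᵃ` is the disjoint union of the `Gˡ` with `|l| ≤ |k|`
    BottMorse.critBelow n a = ⋃ l : BottMorse.LatticeBall k, BottMorse.G l.1 ∧
    Pairwise (Function.onFun Disjoint
      fun l : BottMorse.LatticeBall k ↦ BottMorse.G l.1) ∧
    -- the chain complex is that of the topological disjoint union of the `Gˡ`
    Nonempty (BottMorse.CM n a ≅
      BottMorse.singularChains (TopCat.of (Σ l : BottMorse.LatticeBall k, BottMorse.G l.1))) ∧
    -- the homology is that of a disjoint union of copies of `Tⁿ`
    (∀ i : ℤ, Nonempty (BottMorse.HM n a i ≃ₗ[ℤ]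
      BottMorse.singularHomology
        (TopCat.of (Σ _ : BottMorse.LatticeBall k, BottMorse.Torus n)) i)) ∧
    (∀ i : ℕ, i ≤ n → Nonempty (BottMorse.HM n a (i : ℤ) ≃ₗ[ℤ]
      ⨁ _ : BottMorse.LatticeBall k, (Fin (n.choose i) → ℤ))) ∧
    (∀ i : ℤ, i < 0 ∨ (n : ℤ) < i → Subsingleton (BottMorse.HM n a i)) := by
  open BottMorse in
  obtain ⟨eG⟩ := nonempty_sigma_G_homeomorph k ha
  obtain ⟨eT⟩ := nonempty_sigma_torus_homeomorph k ha
  refine ⟨ha ▸ critBelow_eq_iUnion k, fun l l' h ↦ G_disjoint fun h' ↦ h (Subtype.ext h'),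
    ⟨singularChainsIso eG.symm⟩, fun i ↦ ?_, fun i _ ↦ ?_, fun i hi ↦ ?_⟩
  · exact ⟨((HomologicalComplex.homologyFunctor _ _ i).mapIso
      (singularChainsIso eT.symm)).toLinearEquiv.toAddEquiv.toIntLinearEquiv⟩
  · obtain ⟨e⟩ := (isFreeOfRank_HM k ha i).nonempty_equiv
      (isFreeOfRank_directSum (LatticeBall k) (n.choose i))
    exact ⟨e.toIntLinearEquiv⟩
  · obtain hi | hi := lt_or_ge i 0
    · exact subsingleton_singularHomology_of_neg _ hi
    · lift i to ℕ using hi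
      have h := isFreeOfRank_HM k ha i
      rw [Nat.choose_eq_zero_of_lt (by omega), mul_zero] at h
      exact subsingleton_of_isFreeOfRank_zero h
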